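/- Let $\mathbb H^3=\{x+yj : x\in\mathbb C,\ y>0\}$, with coordinates $x(z)=x$, $y(z)=y$ and $\phi_1(z)=-\log y(z)$, with the action of $\mathrm{SL}_2(\mathbb C)$ by the fractional linear transformations $z\mapsto(az+b)(cz+d)^{-1}$ of quaternions, and with closure $\overline{\mathbb H^3}=\mathbb H^3\cup\mathbb C\cup\{\infty\}$. Let $\mathrm{conj}$ be the homomorphism $g\mapsto(X\mapsto gXg^{-1})$ from $\mathrm{SL}_2(\mathbb C)$ to the linear automorphisms of $\mathfrak{sl}_2(\mathbb C)$, written as $3\times 3$ matrices in the basis $X_1=\begin{pmatrix}0&1\\1&0\end{pmatrix}$, $X_2=\begin{pmatrix}0&i\\-i&0\end{pmatrix}$, $Y=\begin{pmatrix}1&0\\0&-1\end{pmatrix}$, which is orthonormal for $\frac12\mathrm{Tr}(XY)$. Let $\Gamma=\mathrm{conj}^{-1}(\mathrm{SO}(3,\mathbb Z[i]))\subset\mathrm{SL}_2(\mathbb C)$. Definitions. An exact fundamental domain for a group $\Delta$ of homeomorphisms of a space $X$ is a set $F\subseteq X$ with $X=\Delta F$ and $\gamma_1F\cap\gamma_2F\subseteq\gamma_1\partial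 F\cap\gamma_2\partial F$ for all $\gamma_1\ne\gamma_2$ in $\Delta$. For a subgroup $\Gamma'$ of $\mathrm{SL}_2(\mathbb C)$ commensurable with $\mathrm{SL}_2(\mathbb Z[i])$, let $\Gamma'^{\phi_1}=\{\gamma\in\Gamma' : \phi_1\circ\gamma=\phi_1\}$, which acts on $\mathbb C$ by $t\mapsto x(\gamma(t+j))$. Let $G\subseteq\mathbb C$ be an exact fundamental domain for the group of homeomorphisms of $\mathbb C$ given by $\Gamma'^{\phi_1}$, with $G$ equal to the closure of its interior. If the set $\{z\in\mathbb H^3 : x(z)\in G,\ \phi_1(z)\le\phi_1(\gamma z)\text{ for all }\gamma\in\Gamma'\}$ is an exact fundamental domain for the group of homeomorphisms of $\mathbb H^3$ given by $\Gamma'$, it is called the good Grenier fundamental domain for the action of $\Gamma'$ on $\mathbb H^3$ associated to $G$. The solid convex polytope with vertices $p_1,\dots,p_r\in\overline{\mathbb H^3}$ ($r>3$) is their hyperbolic convex hull in $\overline{\mathbb H^3}$; here the $p_i$ must not all lie on the closure of one totally geodesic surface, and no $p_i$ may lie in the convex hull of the others. Proposition. Let $T\subset\mathbb C$ be the closed triangle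 with vertices $1$, $2$ and $1+i$, and let $P\subset\overline{\mathbb H^3}$ be the hyperbolic convex hull of $1+\sqrt2\,j$, $2+j$, $1+i+j$ and $\infty$. 1. $P$ is a solid convex polytope with these four vertices. 2. $P\cap\mathbb H^3$ is the good Grenier fundamental domain for the action of $\Gamma$ on $\mathbb H^3$ associated to $T$. (In particular $\Gamma$ is commensurable with $\mathrm{SL}_2(\mathbb Z[i])$, $T$ is a fundamental domain for the induced action of $\Gamma^{\phi_1}$ on $\mathbb C$, and $P\cap\mathbb H^3$ is a fundamental domain for $\Gamma$ acting on $\mathbb H^3$.) 3. $P\cap\mathbb H^3=\{z\in\mathbb H^3 : x(z)\in T,\ |x(z)-1|^2+y(z)^2\ge2\}$, and $P$ is the union of this set and $\{\infty\}$. -/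

import Mathlib

namespace GrenierH3

noncomputable section

open Matrix
open scoped Quaternion ComplexConjugate

/-! ### Hyperbolic three-space and the action by fractional linear transformations -/

/-- Upper half-space `ℍ³`: the pair `(x, y)`, with `x : ℂ` and `y > 0`, stands for the
quaternion `x + y j`. -/
abbrev H3 : Type := {p : ℂ × ℝ // 0 < p.2}

namespace H3

/-- The complex coordinate `x(z) = x₁(z) + i x₂(z)` of `z = x(z) + y(z) j`. -/
def x (z : H3) : ℂ := z.1.1

/-- The height `y(z)` of `z = x(z) + y(z) j`. -/
def y (z : H3) : ℝ := z.1.2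

lemma y_pos (z : H3) : 0 < z.y := z.2

lemma ext' {z w : H3} (hx : z.x = w.x) (hy : z.y = w.y) : z = w :=
  Subtype.ext (Prod.ext hx hy)

/-- The quaternion `x(z) + y(z) j`. -/
def toQuaternion (z : H3) : ℍ := ⟨z.x.re, z.x.im, z.y, 0⟩

@[simp] lemma re_toQuaternion (z : H3) : z.toQuaternion.re = z.x.re := rfl
@[simp] lemma imI_toQuaternion (z : H3) : z.toQuaternion.imI = z.x.im := rfl
@[simp] lemma imJ_toQuaternion (z : H3) : z.toQuaternion.imJ = z.y := rfl
@[simp] lemma imK_toQuaternion (z : H3) : z.toQuaternion.imK = 0 := rfl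

lemma toQuaternion_injective : Function.Injective toQuaternion := by
  intro z w h
  have h1 := congrArg QuaternionAlgebra.re h
  have h2 := congrArg QuaternionAlgebra.imI h
  have h3 := congrArg QuaternionAlgebra.imJ h
  exact ext' (Complex.ext h1 h2) h3

/-- The squared norm `‖c z + d‖² = |c x + d|² + |c|² y²` of the quaternion `c z + d`. -/
def den (g : SpecialLinearGroup (Fin 2) ℂ) (z : H3) : ℝ :=
  Complex.normSq (g 1 0 * z.x + g 1 1) + Complex.normSq (g 1 0) * z.y ^ 2

lemma den_pos (g : SpecialLinearGroup (Fin 2) ℂ) (z : H3) : 0 < den g z := by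
  unfold den
  have hy := z.y_pos
  by_cases hc : g 1 0 = 0
  · have hd : g 1 1 ≠ 0 := by
      intro hd
      have := g.det_coe
      rw [Matrix.det_fin_two, hc, hd] at this
      simp at this
    simpa [hc] using hd
  · have h1 : 0 < Complex.normSq (g 1 0) := Complex.normSq_pos.2 hc
    have h2 := Complex.normSq_nonneg (g 1 0 * z.x + g 1 1)
    positivity

/-- The action of `SL(2, ℂ)` on `ℍ³` by `z ↦ (a z + b) (c z + d)⁻¹`, in coordinates; the formula
with quaternions is `H3.toQuaternion_smul`. -/
instance : SMul (SpecialLinearGroup (Fin 2) ℂ) H3 where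
  smul g z :=
    ⟨(((g 0 0 * z.x + g 0 1) * conj (g 1 0 * z.x + g 1 1)
          + g 0 0 * conj (g 1 0) * (z.y : ℂ) ^ 2) / (den g z : ℂ),
      z.y / den g z), div_pos z.y_pos (den_pos g z)⟩

lemma x_smul (g : SpecialLinearGroup (Fin 2) ℂ) (z : H3) :
    (g • z).x = ((g 0 0 * z.x + g 0 1) * conj (g 1 0 * z.x + g 1 1)
          + g 0 0 * conj (g 1 0) * (z.y : ℂ) ^ 2) / (den g z : ℂ) := rfl

lemma y_smul (g : SpecialLinearGroup (Fin 2) ℂ) (z : H3) : (g • z).y = z.y / den g z := rfl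

lemma normSq_denom (g : SpecialLinearGroup (Fin 2) ℂ) (z : H3) :
    Quaternion.normSq ((g 1 0 : ℂ) * z.toQuaternion + (g 1 1 : ℂ) : ℍ) = den g z := by
  simp [Quaternion.normSq_def', den, Complex.normSq_apply]
  ring

lemma denom_ne_zero (g : SpecialLinearGroup (Fin 2) ℂ) (z : H3) :
    ((g 1 0 : ℂ) * z.toQuaternion + (g 1 1 : ℂ) : ℍ) ≠ 0 := by
  intro h
  have := normSq_denom g z
  rw [h, map_zero] at this
  exact (den_pos g z).ne this

/-- `SL(2, ℂ)` acts by the fractional linear transformations `z ↦ (a z + b) (c z + d)⁻¹` of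
quaternions. -/
lemma toQuaternion_smul (g : SpecialLinearGroup (Fin 2) ℂ) (z : H3) :
    (g • z).toQuaternion =
      ((g 0 0 : ℂ) * z.toQuaternion + (g 0 1 : ℂ)) *
        ((g 1 0 : ℂ) * z.toQuaternion + (g 1 1 : ℂ))⁻¹ := by
  have hdet : g 0 0 * g 1 1 - g 0 1 * g 1 0 = 1 := by
    rw [← Matrix.det_fin_two]
    exact g.det_coe
  have hre := congrArg Complex.re hdet
  have him := congrArg Complex.im hdet
  simp at hre him
  have hx : (g • z).x = ((den g z)⁻¹ : ℝ) * ((g 0 0 * z.x + g 0 1) * conj (g 1 0 * z.x + g 1 1)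
          + g 0 0 * conj (g 1 0) * (z.y : ℂ) ^ 2) := by
    rw [x_smul, div_eq_inv_mul, Complex.ofReal_inv]
  rw [Quaternion.inv_def, normSq_denom, mul_smul_comm]
  ext
  · rw [re_toQuaternion, hx, Complex.re_ofReal_mul]
    simp [pow_two]
    left; ring
  · rw [imI_toQuaternion, hx, Complex.im_ofReal_mul]
    simp [pow_two]
    left; ring
  · rw [imJ_toQuaternion, y_smul, div_eq_inv_mul]
    simp
    left; linear_combination (-z.y) * hre
  · rw [imK_toQuaternion]
    simp
    right; linear_combination z.y * him

instance : MulAction (SpecialLinearGroup (Fin 2) ℂ) H3 where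
  one_smul z := by
    apply toQuaternion_injective
    rw [toQuaternion_smul]
    simp
  mul_smul g h z := by
    apply toQuaternion_injective
    rw [toQuaternion_smul, toQuaternion_smul, toQuaternion_smul]
    have hz := denom_ne_zero h z
    set q := ((h 1 0 : ℂ) * z.toQuaternion + (h 1 1 : ℂ) : ℍ) with hq
    have key : ∀ a b : ℂ, (a : ℍ) * (((h 0 0 : ℂ) * z.toQuaternion + (h 0 1 : ℂ)) * q⁻¹) + (b : ℍ)
        = (((a * h 0 0 + b * h 1 0 : ℂ) : ℍ) * z.toQuaternion
            + ((a * h 0 1 + b * h 1 1 : ℂ) : ℍ)) * q⁻¹ := by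
      intro a b
      rw [eq_mul_inv_iff_mul_eq₀ hz, add_mul, mul_assoc, mul_assoc, inv_mul_cancel₀ hz, mul_one, hq]
      simp only [Quaternion.coeComplex_add, Quaternion.coeComplex_mul]
      noncomm_ring
    rw [key, key, _root_.mul_inv_rev, inv_inv, mul_assoc, inv_mul_cancel_left₀ hz]
    simp [Matrix.mul_apply, Fin.sum_univ_two]

lemma continuous_x : Continuous x := continuous_fst.comp continuous_subtype_val

lemma continuous_y : Continuous y := continuous_snd.comp continuous_subtype_val

lemma continuous_smul (g : SpecialLinearGroup (Fin 2) ℂ) : Continuous (fun z : H3 => g • z) := by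
  have hx := continuous_x
  have hy := continuous_y
  have hd : Continuous (den g) := by
    unfold den
    have := Complex.continuous_normSq
    fun_prop
  refine Continuous.subtype_mk (Continuous.prodMk ?_ ?_) _
  · refine Continuous.div ?_ (Complex.continuous_ofReal.comp hd) fun z => ?_
    · have := Complex.continuous_conj
      fun_prop
    · exact_mod_cast (den_pos g z).ne'
  · exact hy.div hd fun z => (den_pos g z).ne'

/-- The action of `SL(2, ℂ)` on `ℍ³`, as a homomorphism to the group of homeomorphisms of `ℍ³`.
The group of transformations induced by `Γ` is `Γ.map H3.act`; it is the quotient of `Γ` by the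
kernel `Γ ∩ {±1}` of the action. -/
def act : SpecialLinearGroup (Fin 2) ℂ →* (H3 ≃ₜ H3) where
  toFun g :=
    { toEquiv := MulAction.toPerm g
      continuous_toFun := continuous_smul g
      continuous_invFun := continuous_smul g⁻¹ }
  map_one' := by ext1 z; exact one_smul (SpecialLinearGroup (Fin 2) ℂ) z
  map_mul' g h := by ext1 z; exact mul_smul g h z

/-- The coordinate `φ₁ = -log y`. -/
def phi1 (z : H3) : ℝ := -Real.log z.y

/-- The projection `φ_{[2,3]} = (x₁, x₂)`, with values in `ℂ ≅ ℝ²`. -/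
def phi23 (z : H3) : ℂ := z.x

/-- The zero section `t ↦ t + j` of `φ_{[2,3]}`: the point with `φ₁ = 0` and `φ_{[2,3]} = t`. -/
def section23 (t : ℂ) : H3 := ⟨(t, 1), one_pos⟩

lemma phi1_inj {z w : H3} : phi1 z = phi1 w ↔ z.y = w.y := by
  unfold phi1
  rw [neg_inj]
  exact ⟨fun h => Real.log_injOn_pos z.y_pos w.y_pos h, fun h => by rw [h]⟩

end H3

open H3

/-! ### Exact fundamental domains and good Grenier fundamental domains -/

/-- `F` is an exact fundamental domain for the group `Γ` of homeomorphisms of `X`: the translates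
of `F` cover `X`, and distinct translates meet only on their boundaries. -/
structure IsFundamentalDomain {X : Type*} [TopologicalSpace X] (Γ : Subgroup (X ≃ₜ X))
    (F : Set X) : Prop where
  cover : ⋃ γ ∈ Γ, γ '' F = Set.univ
  inter : ∀ γ₁ ∈ Γ, ∀ γ₂ ∈ Γ, γ₁ ≠ γ₂ →
    γ₁ '' F ∩ γ₂ '' F ⊆ γ₁ '' frontier F ∩ γ₂ '' frontier F

/-- `Γ^{φ₁}`, the subgroup of the elements of `Γ` that preserve the coordinate `φ₁`. -/
def stabPhi1 (Γ : Subgroup (SpecialLinearGroup (Fin 2) ℂ)) :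
    Subgroup (SpecialLinearGroup (Fin 2) ℂ) where
  carrier := {γ | γ ∈ Γ ∧ ∀ z : H3, phi1 (γ • z) = phi1 z}
  one_mem' := ⟨Γ.one_mem, fun z => by rw [one_smul]⟩
  mul_mem' := fun {a b} ha hb =>
    ⟨Γ.mul_mem ha.1 hb.1, fun z => by rw [mul_smul, ha.2, hb.2]⟩
  inv_mem' := fun {a} ha =>
    ⟨Γ.inv_mem ha.1, fun z => by rw [← ha.2 (a⁻¹ • z), smul_inv_smul]⟩

lemma smul_section23 {Γ : Subgroup (SpecialLinearGroup (Fin 2) ℂ)}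
    {γ : SpecialLinearGroup (Fin 2) ℂ} (hγ : γ ∈ stabPhi1 Γ) (t : ℂ) :
    section23 (phi23 (γ • section23 t)) = γ • section23 t :=
  H3.ext' rfl (phi1_inj.1 (hγ.2 (section23 t))).symm

/-- The induced action of `Γ^{φ₁}` on `ℂ ≅ ℝ²`: the element `γ` acts by
`t ↦ φ_{[2,3]} (γ (t + j))`. -/
def inducedAct (Γ : Subgroup (SpecialLinearGroup (Fin 2) ℂ)) : stabPhi1 Γ →* (ℂ ≃ₜ ℂ) where
  toFun γ :=
    { toFun := fun t => phi23 (γ.1 • section23 t)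
      invFun := fun t => phi23 (γ.1⁻¹ • section23 t)
      left_inv := fun t => by
        simp only [smul_section23 γ.2, inv_smul_smul]
        rfl
      right_inv := fun t => by
        have := smul_section23 (γ⁻¹).2 t
        rw [Subgroup.coe_inv] at this
        simp only [this, smul_inv_smul]
        rfl
      continuous_toFun := continuous_x.comp ((continuous_smul γ.1).comp
        (Continuous.subtype_mk (by fun_prop) _))
      continuous_invFun := continuous_x.comp ((continuous_smul γ.1⁻¹).comp
        (Continuous.subtype_mk (by fun_prop) _)) }
  map_one' := by
    ext1 t
    change phi23 ((1 : SpecialLinearGroup (Fin 2) ℂ) • section23 t) = t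
    rw [one_smul]
    rfl
  map_mul' g h := by
    ext1 t
    change phi23 ((g.1 * h.1) • section23 t) =
      phi23 (g.1 • section23 (phi23 (h.1 • section23 t)))
    rw [smul_section23 h.2, mul_smul]

/-- The set `F₁` of the points at which `φ₁` is minimal (the height is maximal) on the
`Γ`-orbit. -/
def F1 (Γ : Subgroup (SpecialLinearGroup (Fin 2) ℂ)) : Set H3 :=
  {z | ∀ γ ∈ Γ, phi1 z ≤ phi1 (γ • z)}

/-- `SL(2, ℤ[i])` as a subgroup of `SL(2, ℂ)`. -/
def SL2Zi : Subgroup (SpecialLinearGroup (Fin 2) ℂ) :=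
  (SpecialLinearGroup.map (n := Fin 2) GaussianInt.toComplex).range

/-- `F` is the good Grenier fundamental domain for the action of `Γ` on `ℍ³` that is associated to
the fundamental domain `G` for the induced action of `Γ^{φ₁}` on `ℂ ≅ ℝ²`. -/
structure IsGoodGrenierDomain (Γ : Subgroup (SpecialLinearGroup (Fin 2) ℂ)) (G : Set ℂ)
    (F : Set H3) : Prop where
  commensurable : Subgroup.Commensurable Γ SL2Zi
  base : IsFundamentalDomain (inducedAct Γ).range G
  base_eq : G = closure (interior G)
  eq : F = phi23 ⁻¹' G ∩ F1 Γ
  fundamental : IsFundamentalDomain (Γ.map H3.act) F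

/-! ### The group `conj⁻¹(SO(3, ℤ[i]))` -/

/-- `𝔰𝔩₂(ℂ)`, the traceless matrices. -/
abbrev sl2 : Type := LieAlgebra.SpecialLinear.sl (Fin 2) ℂ

lemma trace_sl2 (X : sl2) : Matrix.trace X.1 = 0 := X.2

/-- The conjugation action `conj(g) X = g X g⁻¹` of `SL(2, ℂ)` on `𝔰𝔩₂(ℂ)`. -/
def conjEnd : SpecialLinearGroup (Fin 2) ℂ →* Module.End ℂ sl2 where
  toFun g :=
    { toFun := fun X => ⟨g.1 * X.1 * (g⁻¹).1, by
        change Matrix.trace (g.1 * X.1 * (g⁻¹).1) = 0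
        have h : (g⁻¹).1 * g.1 = 1 := congrArg Subtype.val (inv_mul_cancel g)
        rw [Matrix.trace_mul_comm, ← mul_assoc, h, one_mul]
        exact trace_sl2 X⟩
      map_add' := fun X Y => Subtype.ext (by
        change g.1 * (X.1 + Y.1) * (g⁻¹).1 = g.1 * X.1 * (g⁻¹).1 + g.1 * Y.1 * (g⁻¹).1
        rw [mul_add, add_mul])
      map_smul' := fun c X => Subtype.ext (by
        change g.1 * (c • X.1) * (g⁻¹).1 = c • (g.1 * X.1 * (g⁻¹).1)
        rw [mul_smul_comm, smul_mul_assoc]) }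
  map_one' := by
    ext1 X
    apply Subtype.ext
    change (1 : SpecialLinearGroup (Fin 2) ℂ).1 * X.1 * (1⁻¹ : SpecialLinearGroup (Fin 2) ℂ).1 = X.1
    rw [inv_one]
    change (1 : Matrix (Fin 2) (Fin 2) ℂ) * X.1 * 1 = X.1
    rw [one_mul, mul_one]
  map_mul' g h := by
    ext1 X
    apply Subtype.ext
    change (g * h).1 * X.1 * ((g * h)⁻¹).1 = g.1 * (h.1 * X.1 * (h⁻¹).1) * (g⁻¹).1
    rw [_root_.mul_inv_rev]
    change (g.1 * h.1) * X.1 * ((h⁻¹).1 * (g⁻¹).1) = _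
    simp only [mul_assoc]

/-- The basis `X₁ = E₁₂ + E₂₁`, `X₂ = i (E₁₂ - E₂₁)`, `Y = E₁₁ - E₂₂` of `𝔰𝔩₂(ℂ)`, orthonormal
for the half-trace form `B(X, Y) = ½ tr(X Y)`; see `beta_apply`. -/
def beta : Module.Basis (Fin 3) ℂ sl2 :=
  Module.Basis.ofEquivFun
    { toFun := fun X => ![(X.1 0 1 + X.1 1 0) / 2, (X.1 0 1 - X.1 1 0) / (2 * Complex.I), X.1 0 0]
      invFun := fun v => ⟨!![v 2, v 0 + Complex.I * v 1; v 0 - Complex.I * v 1, -v 2], by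
        change Matrix.trace !![v 2, v 0 + Complex.I * v 1; v 0 - Complex.I * v 1, -v 2] = 0
        simp [Matrix.trace_fin_two]⟩
      map_add' := fun X Y => by
        ext i
        fin_cases i <;> simp <;> ring
      map_smul' := fun c X => by
        ext i
        fin_cases i <;> simp <;> ring
      left_inv := fun X => by
        have h := trace_sl2 X
        rw [Matrix.trace_fin_two] at h
        apply Subtype.ext
        ext i j
        fin_cases i <;> fin_cases j
        · simp
        · simp
          field_simp
          ring
        · simp
          field_simp
          ring
        · simp
          linear_combination -h
      right_inv := fun v => by
        ext i
        fin_cases i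
        · simp
        · simp
          field_simp
          ring
        · simp }

lemma beta_apply :
    (beta 0).1 = !![0, 1; 1, 0] ∧ (beta 1).1 = !![0, Complex.I; -Complex.I, 0] ∧
      (beta 2).1 = !![1, 0; 0, -1] := by
  refine ⟨?_, ?_, ?_⟩ <;>
  · simp [beta, Module.Basis.coe_ofEquivFun]

/-- `conj` in matrix form, with respect to the basis `beta`. -/
def conjHom : SpecialLinearGroup (Fin 2) ℂ →* GL (Fin 3) ℂ :=
  MonoidHom.toHomUnits
    (((LinearMap.toMatrixAlgEquiv beta : Module.End ℂ sl2 ≃ₐ[ℂ] Matrix (Fin 3) (Fin 3) ℂ) :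
      Module.End ℂ sl2 →* Matrix (Fin 3) (Fin 3) ℂ).comp conjEnd)

/-- `SO(3, ℤ[i])`: the complex matrices `M` with entries in `ℤ[i]`, `M Mᵗ = 1` and `det M = 1`. -/
def SO3Zi : Subgroup (GL (Fin 3) ℂ) where
  carrier := {M | (∀ i j, M.1 i j ∈ GaussianInt.toComplex.range) ∧ M.1 * M.1ᵀ = 1 ∧ M.1.det = 1}
  one_mem' := by
    refine ⟨fun i j => ?_, by simp, by simp⟩
    rw [Units.val_one, Matrix.one_apply]
    split_ifs
    · exact one_mem _
    · exact zero_mem _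
  mul_mem' := by
    rintro M N ⟨h1, h2, h3⟩ ⟨k1, k2, k3⟩
    refine ⟨fun i j => ?_, ?_, ?_⟩
    · rw [Units.val_mul, Matrix.mul_apply]
      exact sum_mem fun l _ => mul_mem (h1 i l) (k1 l j)
    · rw [Units.val_mul, Matrix.transpose_mul, mul_assoc, ← mul_assoc N.1, k2, one_mul, h2]
    · rw [Units.val_mul, Matrix.det_mul, h3, k3, one_mul]
  inv_mem' := by
    rintro M ⟨h1, h2, h3⟩
    have h : (M⁻¹).1 = M.1ᵀ := Units.inv_eq_of_mul_eq_one_right h2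
    refine ⟨fun i j => ?_, ?_, ?_⟩
    · rw [h]
      exact h1 j i
    · rw [h, Matrix.transpose_transpose]
      exact mul_eq_one_comm.1 h2
    · rw [h, Matrix.det_transpose, h3]

/-- The group `Γ = conj⁻¹(SO(3, ℤ[i]))` in `SL(2, ℂ)`. -/
def Gam : Subgroup (SpecialLinearGroup (Fin 2) ℂ) := SO3Zi.comap conjHom

/-! ### Convex hulls and solid convex polytopes in the closure of `ℍ³` -/

/-- The closed upper half-space `ℍ³ ∪ ℂ`: pairs `(x, y)` with `x : ℂ` and `y ≥ 0`. -/
abbrev HalfSpace : Type := {p : ℂ × ℝ // 0 ≤ p.2}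

/-- The closure `ℍ³ ∪ ℂ ∪ {∞}` of `ℍ³`. -/
abbrev H3bar : Type := OnePoint HalfSpace

/-- The inclusion of `ℍ³` in its closure. -/
def toBar (z : H3) : H3bar := ((⟨z.1, z.2.le⟩ : HalfSpace) : H3bar)

/-- `|x|² + y²`. -/
def HalfSpace.sqNorm (p : HalfSpace) : ℝ := Complex.normSq p.1.1 + p.1.2 ^ 2

/-- The closed geodesic segment between two points of the closure of `ℍ³`.  The geodesics are the
vertical half-lines and the half-circles orthogonal to `ℂ`.  A half-circle is cut out, over a line
of `ℂ`, by an equation `|x - c|² + y² = r²` with `c` on the line, which says that `|x|² + y²` is an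
affine function of the position on the line; so the segment between two finite points is
the set of the points for which the pair `(x, |x|² + y²)` lies on the straight segment between the
two given pairs (over a single `x` this is the vertical segment).  See
`hypSegment_of_circle` and `hypSegment_vertical`. -/
def hypSegment : H3bar → H3bar → Set H3bar
  | some p, some q => {w | ∃ z : HalfSpace, w = (z : H3bar) ∧ ∃ s ∈ Set.Icc (0 : ℝ) 1,
      z.1.1 = (1 - s) * p.1.1 + s * q.1.1 ∧
      z.sqNorm = (1 - s) * p.sqNorm + s * q.sqNorm}
  | some p, none => insert OnePoint.infty
      {w | ∃ z : HalfSpace, w = (z : H3bar) ∧ z.1.1 = p.1.1 ∧ p.1.2 ≤ z.1.2}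
  | none, some q => insert OnePoint.infty
      {w | ∃ z : HalfSpace, w = (z : H3bar) ∧ z.1.1 = q.1.1 ∧ q.1.2 ≤ z.1.2}
  | none, none => {OnePoint.infty}

lemma mem_hypSegment_coe (p q z : HalfSpace) :
    (z : H3bar) ∈ hypSegment p q ↔ ∃ s ∈ Set.Icc (0 : ℝ) 1,
      z.1.1 = (1 - s) * p.1.1 + s * q.1.1 ∧
      z.sqNorm = (1 - s) * p.sqNorm + s * q.sqNorm := by
  constructor
  · rintro ⟨w, hw, h⟩
    rw [OnePoint.coe_injective hw]
    exact h
  · exact fun h => ⟨z, rfl, h⟩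

/-- Two finite points on the half-circle of centre `c` and radius `r` in the vertical plane over
the line through `c` and `c + u`: the segment between them is the arc of this half-circle over
the straight segment between their projections. -/
lemma hypSegment_of_circle (p q : HalfSpace) (c u : ℂ) (r a b : ℝ) (hu : ‖u‖ = 1)
    (hp : p.1.1 = c + a * u) (hq : q.1.1 = c + b * u) (hab : a < b)
    (hpr : a ^ 2 + p.1.2 ^ 2 = r ^ 2) (hqr : b ^ 2 + q.1.2 ^ 2 = r ^ 2) (z : HalfSpace) :
    (z : H3bar) ∈ hypSegment p q ↔
      ∃ t ∈ Set.Icc a b, z.1.1 = c + t * u ∧ t ^ 2 + z.1.2 ^ 2 = r ^ 2 := by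
  have hu' : u.re ^ 2 + u.im ^ 2 = 1 := by
    have := Complex.sq_norm u
    rw [hu, Complex.normSq_apply] at this
    linarith
  have hN : ∀ (w : HalfSpace) (t : ℝ), w.1.1 = c + t * u →
      w.sqNorm = Complex.normSq c + 2 * t * (c.re * u.re + c.im * u.im) + t ^ 2 + w.1.2 ^ 2 := by
    intro w t h
    rw [HalfSpace.sqNorm, h, Complex.normSq_apply, Complex.normSq_apply]
    simp
    linear_combination t ^ 2 * hu'
  rw [mem_hypSegment_coe]
  constructor
  · rintro ⟨s, ⟨h0, h1⟩, hx, hy⟩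
    have hx' : z.1.1 = c + (((1 - s) * a + s * b : ℝ) : ℂ) * u := by
      rw [hx, hp, hq]
      push_cast
      ring
    refine ⟨(1 - s) * a + s * b, ⟨by nlinarith, by nlinarith⟩, hx', ?_⟩
    rw [hN z _ hx', hN p a hp, hN q b hq] at hy
    linear_combination hy + (1 - s) * hpr + s * hqr
  · rintro ⟨t, ⟨h0, h1⟩, hx, hy⟩
    have hba : 0 < b - a := sub_pos.2 hab
    have ht : t = (1 - (t - a) / (b - a)) * a + (t - a) / (b - a) * b := by
      field_simp
      ring
    refine ⟨(t - a) / (b - a), ⟨div_nonneg (by linarith) hba.le,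
      (div_le_one hba).2 (by linarith)⟩, ?_, ?_⟩
    · rw [hx, hp, hq]
      have ht' := congrArg (fun x : ℝ => (x : ℂ)) ht
      push_cast at ht' ⊢
      linear_combination u * ht'
    · rw [hN z t hx, hN p a hp, hN q b hq]
      linear_combination hy - (1 - (t - a) / (b - a)) * hpr - (t - a) / (b - a) * hqr
        + 2 * (c.re * u.re + c.im * u.im) * ht

/-- Over a single point of `ℂ` the segment is the vertical segment. -/
lemma hypSegment_vertical (p q : HalfSpace) (hx : p.1.1 = q.1.1) (hy : p.1.2 ≤ q.1.2)
    (z : HalfSpace) :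
    (z : H3bar) ∈ hypSegment p q ↔ z.1.1 = p.1.1 ∧ z.1.2 ∈ Set.Icc p.1.2 q.1.2 := by
  rw [mem_hypSegment_coe]
  unfold HalfSpace.sqNorm
  have hp0 := p.2
  have hq0 := q.2
  have hz0 := z.2
  constructor
  · rintro ⟨s, ⟨h0, h1⟩, h, hs⟩
    have hzx : z.1.1 = p.1.1 := by
      rw [h, ← hx]
      ring
    have hsq : p.1.2 ^ 2 ≤ q.1.2 ^ 2 := pow_le_pow_left₀ hp0 hy 2
    rw [hzx, ← hx] at hs
    refine ⟨hzx, ?_, ?_⟩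
    · exact (sq_le_sq₀ hp0 hz0).1 (by nlinarith)
    · exact (sq_le_sq₀ hz0 hq0).1 (by nlinarith)
  · rintro ⟨h, h1, h2⟩
    have k1 : p.1.2 ^ 2 ≤ z.1.2 ^ 2 := pow_le_pow_left₀ hp0 h1 2
    have k2 : z.1.2 ^ 2 ≤ q.1.2 ^ 2 := pow_le_pow_left₀ hz0 h2 2
    rw [h, ← hx]
    rcases (k1.trans k2).eq_or_lt with he | hlt
    · refine ⟨0, by simp, by simp, ?_⟩
      linarith
    · have hd : 0 < q.1.2 ^ 2 - p.1.2 ^ 2 := sub_pos.2 hlt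
      refine ⟨(z.1.2 ^ 2 - p.1.2 ^ 2) / (q.1.2 ^ 2 - p.1.2 ^ 2),
        ⟨div_nonneg (by linarith) hd.le, (div_le_one hd).2 (by linarith)⟩, by ring, ?_⟩
      field_simp
      ring

/-- Convex subsets of the closure of `ℍ³`. -/
def HypConvex (S : Set H3bar) : Prop := ∀ p ∈ S, ∀ q ∈ S, hypSegment p q ⊆ S

/-- The hyperbolic convex hull: the smallest convex set that contains `S`. -/
def coh (S : Set H3bar) : Set H3bar := ⋂₀ {C | HypConvex C ∧ S ⊆ C}

/-- The (closures of the) totally geodesic surfaces: vertical half-planes, and upper hemispheres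
centred at points of `ℂ`. -/
def IsTotallyGeodesicSurface (S : Set H3bar) : Prop :=
  (∃ u : ℂ, u ≠ 0 ∧ ∃ k : ℝ,
    S = insert OnePoint.infty
      {w | ∃ z : HalfSpace, w = (z : H3bar) ∧ (conj u * z.1.1).re = k}) ∨
  (∃ c : ℂ, ∃ r : ℝ, 0 < r ∧
    S = {w | ∃ z : HalfSpace, w = (z : H3bar) ∧ ‖z.1.1 - c‖ ^ 2 + z.1.2 ^ 2 = r ^ 2})

/-- `P` is the solid convex polytope with vertices `v 0, …, v (r - 1)`. -/
structure IsSolidConvexPolytope {r : ℕ} (v : Fin r → H3bar) (P : Set H3bar) : Prop where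
  three_lt : 3 < r
  not_coplanar : ¬ ∃ S, IsTotallyGeodesicSurface S ∧ ∀ i, v i ∈ S
  vertex : ∀ i, v i ∉ coh (v '' {i}ᶜ)
  eq_hull : P = coh (Set.range v)

/-- The four vertices `1 + √2 j`, `2 + j`, `1 + i + j` and `∞`. -/
def vertices : Fin 4 → H3bar :=
  ![toBar ⟨(1, √2), Real.sqrt_pos.2 two_pos⟩, toBar ⟨(2, 1), one_pos⟩,
    toBar ⟨(1 + Complex.I, 1), one_pos⟩, OnePoint.infty]

/-- The convex hull of the four vertices in the closure of `ℍ³`. -/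
def polytope : Set H3bar := coh (Set.range vertices)

/-- The triangle in `ℂ` with vertices `1`, `2` and `1 + i`. -/
def triangle : Set ℂ := convexHull ℝ {1, 2, 1 + Complex.I}

end

end GrenierH3

namespace GrenierH3

open Matrix
open scoped Quaternion ComplexConjugate
open H3

/-! For γ in Γ with lower row (c, d), the height of γz is y(z) divided by `den` γ z = |cx + d|² +
|c|²y², so the problem is to bound these denominators from below.

Up to units, the entries of conj(γ) are quadratic forms in a, b, c, d, some of them halved
(`conjHom_matrix`, `mem_Gam_iff`). Hence 2c², 2cd and 2d² are Gaussian integers, although c and d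
need not be. The norm of 2c² is 4|c|⁴, and the values 2 and 3 do not occur; so if c ≠ 0, either |c|²
= 1/2 and d/c is an odd Gaussian integer, or |c| ≥ 1 (`IsConjIntegral.normSq_lower_left`). If c = 0,
γ acts by x ↦ ux + β with u a unit and β divisible by 1 + i, and T is a fundamental domain for these
maps.

The triangle T lies in the closed unit disc about 1, and no odd Gaussian integer is nearer to its
points than 1. So over T the sphere of centre 1 and radius √2 dominates every other isometric
sphere, and the height-maximal points over T are those on or outside it (`domain_eq`). Maximal
heights exist because the triples (2c², 2cd, 2d²) are discrete (`exists_den_le`). In the interior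
the inequalities are strict, which leaves only the trivial transformation
(`isFundamentalDomain_domain`).

Commensurability comes from two congruence conditions: modulo 2 on SL(2, ℤ[i]), and modulo 4 on the
image of Γ in SO(3, ℤ[i]).

For the polytope, geodesic segments between finite points are straight in the coordinates (x, |x|² +
y²). The domain with ∞ is thus an intersection of four convex regions, and it is filled out from the
vertices by segments on the sphere and vertical rays (`polytope_eq`). -/

/-- The ring `ℤ[i]` of Gaussian integers, as a subring of `ℂ`. -/
abbrev ZI : Subring ℂ := GaussianInt.toComplex.range

lemma I_mem_ZI : Complex.I ∈ ZI := ⟨⟨0, 1⟩, by simp [GaussianInt.toComplex_def]⟩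

/-! ### Integrality conditions for membership in Γ -/

lemma det_eq_one (g : SpecialLinearGroup (Fin 2) ℂ) : g 0 0 * g 1 1 - g 0 1 * g 1 0 = 1 := by
  rw [← Matrix.det_fin_two]
  exact g.det_coe

lemma conjHom_matrix (g : SpecialLinearGroup (Fin 2) ℂ) :
    (conjHom g).1 =
      !![(g 0 0 ^ 2 - g 0 1 ^ 2 - g 1 0 ^ 2 + g 1 1 ^ 2) / 2,
          Complex.I * (g 0 0 ^ 2 + g 0 1 ^ 2 - g 1 0 ^ 2 - g 1 1 ^ 2) / 2,
          g 1 0 * g 1 1 - g 0 0 * g 0 1;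
        -Complex.I * (g 0 0 ^ 2 - g 0 1 ^ 2 + g 1 0 ^ 2 - g 1 1 ^ 2) / 2,
          (g 0 0 ^ 2 + g 0 1 ^ 2 + g 1 0 ^ 2 + g 1 1 ^ 2) / 2,
          Complex.I * (g 0 0 * g 0 1 + g 1 0 * g 1 1);
        g 0 1 * g 1 1 - g 0 0 * g 1 0,
          -Complex.I * (g 0 1 * g 1 1 + g 0 0 * g 1 0),
          g 0 0 * g 1 1 + g 0 1 * g 1 0] := by
  have hM : ∀ i j, (conjHom g).1 i j = beta.repr (conjEnd g (beta j)) i := by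
    intro i j
    change LinearMap.toMatrixAlgEquiv beta (conjEnd g) i j = _
    rw [LinearMap.toMatrixAlgEquiv_apply]
  have hr : ∀ X : sl2, ∀ i, beta.repr X i =
      ![(X.1 0 1 + X.1 1 0) / 2, (X.1 0 1 - X.1 1 0) / (2 * Complex.I), X.1 0 0] i := fun X i => rfl
  have hc : ∀ X : sl2, (conjEnd g X).1 = g.1 * X.1 * (g⁻¹).1 := fun X => rfl
  have hI : ∀ w : ℂ, w / (2 * Complex.I) = -Complex.I * w / 2 := by
    intro w
    field_simp
    linear_combination w * Complex.I_sq
  obtain ⟨h0, h1, h2⟩ := beta_apply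
  ext i j
  rw [hM, hr, hc]
  fin_cases j
  · simp only [Fin.zero_eta, h0, hI]
    fin_cases i <;> simp [Matrix.mul_apply, Fin.sum_univ_two, Matrix.adjugate_fin_two] <;> ring
  · simp only [Fin.mk_one, h1, hI]
    fin_cases i <;> simp [Matrix.mul_apply, Fin.sum_univ_two, Matrix.adjugate_fin_two] <;>
      ring_nf <;> simp
  · simp only [Fin.reduceFinMk, h2, hI]
    fin_cases i <;> simp [Matrix.mul_apply, Fin.sum_univ_two, Matrix.adjugate_fin_two] <;> ring

/-- Membership in `Γ`, for a matrix with rows `(a, b)` and `(c, d)`. -/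
structure IsConjIntegral (a b c d : ℂ) : Prop where
  m00 : (a ^ 2 - b ^ 2 - c ^ 2 + d ^ 2) / 2 ∈ ZI
  m01 : (a ^ 2 + b ^ 2 - c ^ 2 - d ^ 2) / 2 ∈ ZI
  m02 : c * d - a * b ∈ ZI
  m10 : (a ^ 2 - b ^ 2 + c ^ 2 - d ^ 2) / 2 ∈ ZI
  m11 : (a ^ 2 + b ^ 2 + c ^ 2 + d ^ 2) / 2 ∈ ZI
  m12 : a * b + c * d ∈ ZI
  m20 : b * d - a * c ∈ ZI
  m21 : b * d + a * c ∈ ZI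
  m22 : a * d + b * c ∈ ZI

lemma I_mul_mem_ZI {w : ℂ} : Complex.I * w ∈ ZI ↔ w ∈ ZI := by
  refine ⟨fun h => ?_, fun h => mul_mem I_mem_ZI h⟩
  have := neg_mem (mul_mem I_mem_ZI h)
  rwa [← mul_assoc, Complex.I_mul_I, neg_one_mul, neg_neg] at this

/-- Only integrality is a condition: orthogonality and determinant 1 reduce, on expansion, to (ad -
bc)² = 1 and (ad - bc)³ = 1. The factors ±i of some matrix entries are units and are dropped. -/
lemma mem_Gam_iff (g : SpecialLinearGroup (Fin 2) ℂ) :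
    g ∈ Gam ↔ IsConjIntegral (g 0 0) (g 0 1) (g 1 0) (g 1 1) := by
  have hdet := det_eq_one g
  have hI := Complex.I_sq
  change ((∀ i j, (conjHom g).1 i j ∈ ZI) ∧ (conjHom g).1 * (conjHom g).1ᵀ = 1 ∧
    (conjHom g).1.det = 1) ↔ _
  rw [conjHom_matrix]
  generalize g 0 0 = a at *
  generalize g 0 1 = b at *
  generalize g 1 0 = c at *
  generalize g 1 1 = d at *
  constructor
  · rintro ⟨h, -⟩
    refine ⟨h 0 0, ?_, h 0 2, ?_, h 1 1, ?_, h 2 0, ?_, h 2 2⟩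
    · have := h 0 1
      simp only [Matrix.of_apply, Matrix.cons_val] at this
      rwa [mul_div_assoc, I_mul_mem_ZI] at this
    · have := h 1 0
      simp only [Matrix.of_apply, Matrix.cons_val] at this
      rwa [neg_mul, neg_div, neg_mem_iff, mul_div_assoc, I_mul_mem_ZI] at this
    · have := h 1 2
      simp only [Matrix.of_apply, Matrix.cons_val] at this
      rwa [I_mul_mem_ZI] at this
    · have := h 2 1
      simp only [Matrix.of_apply, Matrix.cons_val] at this
      rwa [neg_mul, neg_mem_iff, I_mul_mem_ZI] at this
  · intro h
    refine ⟨?_, ?_, ?_⟩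
    · intro i j
      fin_cases i <;> fin_cases j
      · exact h.m00
      · have := I_mul_mem_ZI.2 h.m01
        rwa [← mul_div_assoc] at this
      · exact h.m02
      · have := neg_mem (I_mul_mem_ZI.2 h.m10)
        rwa [← mul_div_assoc, ← neg_div, ← neg_mul] at this
      · exact h.m11
      · exact I_mul_mem_ZI.2 h.m12
      · exact h.m20
      · have := neg_mem (I_mul_mem_ZI.2 h.m21)
        rwa [← neg_mul] at this
      · exact h.m22
    · have hd2 : (a * d - b * c) ^ 2 = 1 := by rw [hdet, one_pow]
      ext i j
      fin_cases i <;> fin_cases j <;>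
        simp [Matrix.mul_apply, Fin.sum_univ_three] <;> ring_nf <;> simp only [hI] <;> ring_nf
      all_goals linear_combination hd2
    · have hd3 : (a * d - b * c) ^ 3 = 1 := by rw [hdet, one_pow]
      simp [Matrix.det_fin_three]
      ring_nf
      simp only [hI]
      ring_nf
      linear_combination hd3

/-! ### Arithmetic of the lower row and of the stabiliser of ∞ -/

lemma int_sq_add_sq_eq_two {r s : ℤ} (h : r * r + s * s = 2) :
    (r = 1 ∨ r = -1) ∧ (s = 1 ∨ s = -1) := by
  have hr : r ≤ 1 := by nlinarith
  have hr' : -1 ≤ r := by nlinarith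
  have hs : s ≤ 1 := by nlinarith
  have hs' : -1 ≤ s := by nlinarith
  interval_cases r <;> interval_cases s <;> omega

/-- Applied with w = 2c², v = a² - c², t = 2ac and n₀, n₁, n₂ the first column of the image, up to
units; the second hypothesis is then (ad - bc)² = 1. If w had norm 2, then 1 + i would divide w,
hence t, and then v by the first equation, so it would divide 1. -/
lemma not_norm_eq_two_of_isotropic {w v t n₀ n₁ n₂ : GaussianInt} (h : w * (w + 2 * v) = t ^ 2)
    (hn : n₀ * v - n₁ * (v + w) - n₂ * t = 1) : w.norm ≠ 2 := by
  obtain ⟨r, s⟩ := w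
  obtain ⟨p, q⟩ := v
  obtain ⟨e, f⟩ := t
  obtain ⟨x₀, y₀⟩ := n₀
  obtain ⟨x₁, y₁⟩ := n₁
  obtain ⟨x₂, y₂⟩ := n₂
  intro hw
  simp only [Zsqrtd.ext_iff, pow_two, Zsqrtd.norm_def, Zsqrtd.re_mul, Zsqrtd.im_mul, Zsqrtd.re_add,
    Zsqrtd.im_add, Zsqrtd.re_sub, Zsqrtd.im_sub, Zsqrtd.re_one, Zsqrtd.im_one, Zsqrtd.re_ofNat,
    Zsqrtd.im_ofNat] at h hn hw
  obtain ⟨h1, h2⟩ := h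
  obtain ⟨k1, k2⟩ := hn
  push_cast at h1 h2
  obtain ⟨hr1, hs1⟩ := int_sq_add_sq_eq_two (by linarith : r * r + s * s = 2)
  have hef : Even (e + f) := by
    have : Even (e * e - f * f) := ⟨r * p - s * q, by
      rcases hr1 with rfl | rfl <;> rcases hs1 with rfl | rfl <;> linarith⟩
    simpa [Int.even_sub, Int.even_mul, Int.even_add] using this
  obtain ⟨k, hk⟩ := hef
  have hrs : Even (r + s) := by
    rcases hr1 with rfl | rfl <;> rcases hs1 with rfl | rfl <;> decide
  obtain ⟨l, hl⟩ := hrs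
  have he : e = 2 * k - f := by linarith
  have key : r * p - s * q = 2 * (k * (k - f)) := by
    subst he
    rcases hr1 with rfl | rfl <;> rcases hs1 with rfl | rfl <;> linarith
  have hpq : Even (p + q) := by
    generalize k * (k - f) = m at key
    rcases hr1 with rfl | rfl <;> rcases hs1 with rfl | rfl <;> rw [Int.even_iff] <;> omega
  obtain ⟨m, hm⟩ := hpq
  -- Re + Im modulo 2 is reduction modulo 1 + i; the sum of the real and imaginary parts of the
  -- second hypothesis makes 1 even.
  have hone : (1 : ℤ) = 2 * ((x₀ + y₀) * m - y₀ * q - (x₁ + y₁) * (m + l) + y₁ * (q + s)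
      - (x₂ + y₂) * k + y₂ * f) := by
    linear_combination -k1 - k2 + (x₀ + y₀) * hm - (x₁ + y₁) * (hm + hl) - (x₂ + y₂) * hk
  omega

lemma norm_ne_three (w : GaussianInt) : w.norm ≠ 3 := by
  obtain ⟨r, s⟩ := w
  intro h
  replace h : r * r + s * s = 3 := by
    rw [Zsqrtd.norm_def] at h
    linarith
  have hr : r ≤ 1 := by nlinarith
  have hr' : -1 ≤ r := by nlinarith
  have hs : s ≤ 1 := by nlinarith
  have hs' : -1 ≤ s := by nlinarith
  interval_cases r <;> interval_cases s <;> omega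

lemma gaussian_mul_star_self {w : GaussianInt} (h : w.norm = 1) : w * star w = 1 := by
  rw [← Zsqrtd.norm_eq_mul_conj, h, Int.cast_one]

namespace IsConjIntegral

variable {a b c d : ℂ}

lemma sq_add_sq (h : IsConjIntegral a b c d) : c ^ 2 + d ^ 2 ∈ ZI := by
  convert sub_mem h.m11 h.m01 using 1
  ring

lemma two_sq_left (h : IsConjIntegral a b c d) : 2 * c ^ 2 ∈ ZI := by
  convert add_mem (sub_mem h.m11 h.m01) (sub_mem h.m10 h.m00) using 1
  ring

lemma two_sq_right (h : IsConjIntegral a b c d) : 2 * d ^ 2 ∈ ZI := by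
  convert sub_mem (sub_mem h.m11 h.m01) (sub_mem h.m10 h.m00) using 1
  ring

lemma two_mul (h : IsConjIntegral a b c d) : 2 * c * d ∈ ZI := by
  convert add_mem h.m02 h.m12 using 1
  ring

/-- An isometric sphere of `Γ` has radius at most `1`, or it has radius `√2` and its centre is an
odd Gaussian integer. -/
lemma normSq_lower_left (h : IsConjIntegral a b c d) (hdet : a * d - b * c = 1) (hc : c ≠ 0) :
    (Complex.normSq c = 1 / 2 ∧ ∃ δ : GaussianInt, Odd (δ.re + δ.im) ∧ d = c * δ) ∨
      1 ≤ Complex.normSq c := by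
  obtain ⟨w, hw⟩ := h.two_sq_left
  obtain ⟨t, ht⟩ := h.two_mul
  obtain ⟨u, hu⟩ := h.sq_add_sq
  -- As w = 2c², the positive integer 4|c|⁴ is at least 4 or one of 1, 2, 3, and only 1 survives.
  have hnorm : (w.norm : ℝ) = 4 * Complex.normSq c ^ 2 := by
    rw [GaussianInt.intCast_real_norm, hw, map_mul, map_pow]
    norm_num [Complex.normSq_apply]
  have hc0 : 0 < Complex.normSq c := Complex.normSq_pos.2 hc
  have hpos : 0 < w.norm := by
    have : (0 : ℝ) < w.norm := by rw [hnorm]; positivity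
    exact_mod_cast this
  by_cases h4 : 4 ≤ w.norm
  · right
    have : (4 : ℝ) ≤ w.norm := by exact_mod_cast h4
    nlinarith
  have h2 : w.norm ≠ 2 := by
    obtain ⟨v, hv⟩ : a ^ 2 - c ^ 2 ∈ ZI := by
      convert add_mem h.m00 h.m01 using 1
      ring
    obtain ⟨s, hs⟩ : 2 * a * c ∈ ZI := by
      convert sub_mem h.m21 h.m20 using 1
      ring
    obtain ⟨n₀, hn₀⟩ := h.m00
    obtain ⟨n₁, hn₁⟩ := h.m10
    obtain ⟨n₂, hn₂⟩ := h.m20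
    apply not_norm_eq_two_of_isotropic (v := v) (t := s) (n₀ := n₀) (n₁ := n₁) (n₂ := n₂)
    · apply GaussianInt.toComplex_injective
      simp only [map_mul, map_add, map_pow, map_ofNat, hw, hv, hs]
      ring
    · apply GaussianInt.toComplex_injective
      simp only [map_mul, map_add, map_sub, map_one, hw, hv, hs, hn₀, hn₁, hn₂]
      linear_combination (a * d - b * c + 1) * hdet
  have h3 := norm_ne_three w
  have h1 : w.norm = 1 := by omega
  have hc1 : Complex.normSq c = 1 / 2 := by
    rw [h1, Int.cast_one] at hnorm
    nlinarith
  left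
  have hws := gaussian_mul_star_self h1
  have hws' := congrArg GaussianInt.toComplex hws
  rw [map_mul, map_one, hw] at hws'
  -- Here w is a unit with inverse `star w`, so d/c = 2cd/(2c²) = t · `star w`. Dividing c² + d² = u
  -- by c² gives 1 + δ² = 2u/w, which forces δ to be odd.
  refine ⟨hc1, t * star w, ?_, ?_⟩
  · have hodd : 1 + (t * star w) ^ 2 = 2 * (u * star w) := by
      apply GaussianInt.toComplex_injective
      simp only [map_mul, map_add, map_pow, map_one, map_ofNat, hu, ht]
      linear_combination (-1 : ℂ) * hws' + 2 * d ^ 2 * GaussianInt.toComplex (star w) * hws'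
    generalize t * star w = δ at hodd
    have := congrArg Zsqrtd.re hodd
    simp only [pow_two, Zsqrtd.re_mul, Zsqrtd.re_add, Zsqrtd.re_one, Zsqrtd.re_ofNat,
      Zsqrtd.im_ofNat] at this
    have he : Even (1 + δ.re * δ.re - δ.im * δ.im) := ⟨(u * star w).re, by
      simp only [Zsqrtd.re_mul]
      push_cast at this
      linarith⟩
    rw [← Int.not_even_iff_odd]
    simp only [Int.even_sub, Int.even_mul, Int.even_add, Int.not_even_one] at he ⊢
    tauto
  · rw [map_mul, ht]
    linear_combination (-d) * hws'

/-- The stabiliser of `∞` in `Γ` acts by the maps `t ↦ u t + β`, where `u` is a unit and `β` is an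
even Gaussian integer. -/
lemma exists_affine (h : IsConjIntegral a b 0 d) (hdet : a * d = 1) :
    ∃ u β : GaussianInt, u.norm = 1 ∧ Even (β.re + β.im) ∧ a ^ 2 = u ∧ a * b = β := by
  obtain ⟨u, hu⟩ : a ^ 2 ∈ ZI := by
    convert add_mem h.m00 h.m01 using 1
    ring
  obtain ⟨v, hv⟩ : d ^ 2 ∈ ZI := by
    convert h.sq_add_sq using 1
    ring
  obtain ⟨β, hβ⟩ : a * b ∈ ZI := by
    convert h.m12 using 1
    ring
  obtain ⟨k, hk⟩ := h.m00
  have huv : u * v = 1 := by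
    apply GaussianInt.toComplex_injective
    rw [map_mul, map_one, hu, hv]
    linear_combination (a * d + 1) * hdet
  have hu1 : u.norm = 1 := by
    have := congrArg Zsqrtd.norm huv
    rw [Zsqrtd.norm_mul, Zsqrtd.norm_one] at this
    exact Int.eq_one_of_mul_eq_one_right (GaussianInt.norm_nonneg u) this
  refine ⟨u, β, hu1, ?_, hu.symm, hβ.symm⟩
  -- The upper left entry (a² - b² + d²)/2 = k, multiplied by 2a² = 2u. Since |u| = 1, the real part
  -- of u² + 1 is even, hence so is that of β².
  have he : u ^ 2 - β ^ 2 + 1 = 2 * (k * u) := by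
    apply GaussianInt.toComplex_injective
    simp only [map_mul, map_add, map_sub, map_pow, map_one, map_ofNat, hu, hβ, hk]
    linear_combination (-a * d - 1) * hdet
  have hre := congrArg Zsqrtd.re he
  rw [Zsqrtd.norm_def] at hu1
  simp only [pow_two, Zsqrtd.re_mul, Zsqrtd.im_mul, Zsqrtd.re_add, Zsqrtd.re_sub, Zsqrtd.re_one,
    Zsqrtd.re_ofNat, Zsqrtd.im_ofNat] at hre
  push_cast at hre
  have he2 : Even (β.re * β.re - β.im * β.im) :=
    ⟨1 - u.im * u.im - (k.re * u.re - k.im * u.im), by linarith⟩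
  simpa [Int.even_sub, Int.even_mul, Int.even_add] using he2

end IsConjIntegral

/-! ### Elements of Γ that are needed -/

/-- The diagonal entry a is a complex square root of u, possibly outside ℤ[i]. Writing β = (1 + i)σ
gives β² = 2iσ², and this factor 2 absorbs the halves in the integrality conditions. -/
lemma exists_mem_Gam_affine {u β : GaussianInt} (hu : u.norm = 1) (hβ : Even (β.re + β.im)) :
    ∃ g ∈ Gam, g 1 0 = 0 ∧ g 0 0 ^ 2 = u ∧ g 0 0 * g 0 1 = β := by
  obtain ⟨a, ha⟩ := IsAlgClosed.exists_pow_nat_eq (GaussianInt.toComplex u) (n := 2) two_pos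
  have huu := congrArg GaussianInt.toComplex (gaussian_mul_star_self hu)
  rw [map_mul, map_one] at huu
  have ha0 : a ≠ 0 := by
    rintro rfl
    rw [← ha] at huu
    simp at huu
  obtain ⟨σ, hσ⟩ : ∃ σ : GaussianInt, β = ⟨1, 1⟩ * σ := by
    obtain ⟨k, hk⟩ := hβ
    refine ⟨⟨k, k - β.re⟩, ?_⟩
    ext
    · simp
    · simp
      linarith
  have hββ : (β : ℂ) ^ 2 = 2 * (Complex.I * (σ : ℂ) ^ 2) := by
    rw [hσ, map_mul]
    simp only [GaussianInt.toComplex_def']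
    push_cast
    linear_combination (σ : ℂ) ^ 2 * Complex.I_sq
  have hre : (u : ℂ) + (star u : GaussianInt) = 2 * (u.re : ℂ) := by
    simp [GaussianInt.toComplex_def]
    ring
  have him : (u : ℂ) - (star u : GaussianInt) = 2 * (Complex.I * u.im) := by
    simp [GaussianInt.toComplex_def]
    ring
  have hA : ((a⁻¹) ^ 2) = (star u : GaussianInt) := by
    rw [inv_pow, ha]
    exact inv_eq_of_mul_eq_one_right huu
  have hB : (β * a⁻¹ : ℂ) ^ 2 = 2 * (Complex.I * (σ : ℂ) ^ 2) * (star u : GaussianInt) := by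
    rw [mul_pow, hA, hββ]
  have hG : ∀ w : GaussianInt, (w : ℂ) ∈ ZI := fun w => ⟨w, rfl⟩
  have hZ : ∀ w : ℤ, (w : ℂ) ∈ ZI := fun w => intCast_mem _ w
  have hq : Complex.I * (σ : ℂ) ^ 2 * (star u : GaussianInt) ∈ ZI :=
    mul_mem (mul_mem I_mem_ZI (pow_mem (hG _) 2)) (hG _)
  have hab : a * (β * a⁻¹) = (β : ℂ) := by field_simp
  refine ⟨⟨!![a, β * a⁻¹; 0, a⁻¹], ?_⟩, ?_, ?_, ?_, ?_⟩
  · rw [Matrix.det_fin_two_of]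
    field_simp
    ring
  · apply (mem_Gam_iff _).2
    change IsConjIntegral a (β * a⁻¹) 0 a⁻¹
    refine ⟨?_, ?_, ?_, ?_, ?_, ?_, ?_, ?_, ?_⟩
    · rw [ha, hA, hB]
      convert sub_mem (hZ u.re) hq using 1
      linear_combination hre / 2
    · rw [ha, hA, hB]
      convert add_mem (I_mul_mem_ZI.2 (hZ u.im)) hq using 1
      linear_combination him / 2
    · rw [hab]
      simp
    · rw [ha, hA, hB]
      convert sub_mem (I_mul_mem_ZI.2 (hZ u.im)) hq using 1
      linear_combination him / 2
    · rw [ha, hA, hB]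
      convert add_mem (hZ u.re) hq using 1
      linear_combination hre / 2
    · rw [hab]
      simp
    · convert mul_mem (hG β) (hG (star u)) using 1
      rw [← hA]
      ring
    · convert mul_mem (hG β) (hG (star u)) using 1
      rw [← hA]
      ring
    · convert one_mem ZI using 1
      field_simp
      ring
  · simp
  · simpa using ha
  · simpa using hab

/-- The element `z ↦ (z + 1) (1 - z)⁻¹` of `Γ`, whose isometric sphere has centre `1` and radius
`√2`. -/
lemma exists_mem_Gam_isometric_sphere :
    ∃ g ∈ Gam, g 1 1 = -g 1 0 ∧ Complex.normSq (g 1 0) = 1 / 2 := by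
  have hs : ((√2 : ℝ) : ℂ)⁻¹ ^ 2 = 1 / 2 := by
    rw [inv_pow, ← Complex.ofReal_pow, Real.sq_sqrt zero_le_two]
    norm_num
  have hsq : ((√2 : ℝ) : ℂ)⁻¹ * ((√2 : ℝ) : ℂ)⁻¹ = 1 / 2 := by rw [← pow_two, hs]
  have hn : Complex.normSq (((√2 : ℝ) : ℂ)⁻¹) = 1 / 2 := by
    rw [← Complex.ofReal_inv, Complex.normSq_ofReal, ← mul_inv, Real.mul_self_sqrt zero_le_two]
    norm_num
  generalize ((√2 : ℝ) : ℂ)⁻¹ = s at hs hsq hn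
  refine ⟨⟨!![s, s; -s, s], ?_⟩, ?_, ?_, ?_⟩
  · rw [Matrix.det_fin_two_of]
    linear_combination 2 * hsq
  · apply (mem_Gam_iff _).2
    change IsConjIntegral s s (-s) s
    refine ⟨?_, ?_, ?_, ?_, ?_, ?_, ?_, ?_, ?_⟩ <;> ring_nf <;> (try rw [hs]) <;>
      norm_num
  · simp
  · simpa using hn

/-! ### Commensurability with SL(2, ℤ[i]) -/

/-- An invariant with finitely many values that separates the cosets of H in K bounds their number.
It is used with residues of matrix entries. -/
lemma relIndex_ne_zero_of_invariant {G α : Type*} [Group G] [Finite α] (H K : Subgroup G)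
    (f : G → α) (hf : ∀ x ∈ K, ∀ y ∈ K, f x = f y → x⁻¹ * y ∈ H) : H.relIndex K ≠ 0 := by
  have : Finite (K ⧸ H.subgroupOf K) := by
    refine Finite.of_injective (fun q : K ⧸ H.subgroupOf K => f q.out) fun p q hpq => ?_
    rw [← p.out_eq, ← q.out_eq]
    apply QuotientGroup.eq.2
    rw [Subgroup.mem_subgroupOf]
    exact hf _ p.out.2 _ q.out.2 hpq
  exact Subgroup.index_ne_zero_of_finite

/-- The residue class modulo `n` of a Gaussian integer (a junk value at other complex numbers). -/
noncomputable def residue (n : ℕ) (w : ℂ) : ZMod n × ZMod n :=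
  ((Function.invFun GaussianInt.toComplex w).re, (Function.invFun GaussianInt.toComplex w).im)

lemma exists_eq_add_of_residue_eq {n : ℕ} {w z : ℂ} (hw : w ∈ ZI) (hz : z ∈ ZI)
    (h : residue n w = residue n z) : ∃ k : GaussianInt, z = w + n * k := by
  obtain ⟨w, rfl⟩ := hw
  obtain ⟨z, rfl⟩ := hz
  unfold residue at h
  rw [Function.leftInverse_invFun GaussianInt.toComplex_injective,
    Function.leftInverse_invFun GaussianInt.toComplex_injective, Prod.mk.injEq,
    ZMod.intCast_eq_intCast_iff_dvd_sub, ZMod.intCast_eq_intCast_iff_dvd_sub] at h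
  obtain ⟨⟨k, hk⟩, l, hl⟩ := h
  refine ⟨⟨k, l⟩, ?_⟩
  have : z = w + n * ⟨k, l⟩ := by
    ext
    · simp [← hk]
    · simp [← hl]
  rw [this, map_add, map_mul, map_natCast]

/-- The principal congruence subgroup of level 2 lies in Γ: the square of an odd entry 1 + 2p is 1
modulo 4, so each halved sum is integral. -/
lemma isConjIntegral_of_congr_one (p q r s : GaussianInt) :
    IsConjIntegral (1 + 2 * p) (2 * q) (2 * r) (1 + 2 * s) where
  m00 := ⟨1 + 2 * p + 2 * p ^ 2 - 2 * q ^ 2 - 2 * r ^ 2 + 2 * s + 2 * s ^ 2, by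
    simp only [map_add, map_sub, map_mul, map_pow, map_one, map_ofNat]; ring⟩
  m01 := ⟨2 * p + 2 * p ^ 2 + 2 * q ^ 2 - 2 * r ^ 2 - 2 * s - 2 * s ^ 2, by
    simp only [map_add, map_sub, map_mul, map_pow, map_ofNat]; ring⟩
  m02 := ⟨2 * r * (1 + 2 * s) - (1 + 2 * p) * (2 * q), by
    simp only [map_add, map_sub, map_mul, map_one, map_ofNat]⟩
  m10 := ⟨2 * p + 2 * p ^ 2 - 2 * q ^ 2 + 2 * r ^ 2 - 2 * s - 2 * s ^ 2, by
    simp only [map_add, map_sub, map_mul, map_pow, map_ofNat]; ring⟩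
  m11 := ⟨1 + 2 * p + 2 * p ^ 2 + 2 * q ^ 2 + 2 * r ^ 2 + 2 * s + 2 * s ^ 2, by
    simp only [map_add, map_mul, map_pow, map_one, map_ofNat]; ring⟩
  m12 := ⟨(1 + 2 * p) * (2 * q) + 2 * r * (1 + 2 * s), by
    simp only [map_add, map_mul, map_one, map_ofNat]⟩
  m20 := ⟨2 * q * (1 + 2 * s) - (1 + 2 * p) * (2 * r), by
    simp only [map_add, map_sub, map_mul, map_one, map_ofNat]⟩
  m21 := ⟨2 * q * (1 + 2 * s) + (1 + 2 * p) * (2 * r), by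
    simp only [map_add, map_mul, map_one, map_ofNat]⟩
  m22 := ⟨(1 + 2 * p) * (1 + 2 * s) + 2 * q * (2 * r), by
    simp only [map_add, map_mul, map_one, map_ofNat]⟩

lemma mem_SL2Zi_iff (g : SpecialLinearGroup (Fin 2) ℂ) : g ∈ SL2Zi ↔ ∀ i j, g i j ∈ ZI := by
  constructor
  · rintro ⟨h, rfl⟩ i j
    exact ⟨h i j, rfl⟩
  · intro h
    choose m hm using h
    refine ⟨⟨Matrix.of m, ?_⟩, ?_⟩
    · apply GaussianInt.toComplex_injective
      rw [Matrix.det_fin_two]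
      simp only [Matrix.of_apply, map_sub, map_mul, map_one, hm]
      exact det_eq_one g
    · ext i j
      exact hm i j

lemma Gam_relIndex_SL2Zi_ne_zero : Gam.relIndex SL2Zi ≠ 0 := by
  apply relIndex_ne_zero_of_invariant Gam SL2Zi (fun g (i j : Fin 2) => residue 2 (g i j))
  intro x hx y hy h
  rw [mem_SL2Zi_iff] at hx hy
  have h' := fun i j => exists_eq_add_of_residue_eq (hx i j) (hy i j) (congrFun (congrFun h i) j)
  choose k hk using h'
  choose m hm using hx
  have hdet := det_eq_one x
  rw [mem_Gam_iff]
  -- With y = x + 2k, the product x⁻¹y is 1 + 2x⁻¹k, and x⁻¹ is the adjugate of x.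
  convert isConjIntegral_of_congr_one (m 1 1 * k 0 0 - m 0 1 * k 1 0)
    (m 1 1 * k 0 1 - m 0 1 * k 1 1) (m 0 0 * k 1 0 - m 1 0 * k 0 0)
    (m 0 0 * k 1 1 - m 1 0 * k 0 1) using 1 <;>
  · simp [Matrix.adjugate_fin_two, Matrix.mul_apply, Fin.sum_univ_two, hk, hm]
    first | linear_combination hdet | ring

/-- Here w is a quotient of Gaussian integers with integral square, and ℤ[i] is integrally closed.
-/
lemma mem_ZI_of_mul_mem {α w : ℂ} (hα : α ∈ ZI) (h0 : α ≠ 0) (h : α * w ∈ ZI)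
    (hw : w ^ 2 ∈ ZI) : w ∈ ZI := by
  obtain ⟨α, rfl⟩ := hα
  obtain ⟨β, hβ⟩ := h
  obtain ⟨v, hv⟩ := hw
  have hd : α ^ 2 ∣ β ^ 2 := ⟨v, by
    apply GaussianInt.toComplex_injective
    rw [map_pow, map_mul, map_pow, hβ, hv]
    ring⟩
  obtain ⟨k, rfl⟩ := (IsIntegrallyClosed.pow_dvd_pow_iff two_ne_zero).1 hd
  refine ⟨k, mul_left_cancel₀ h0 ?_⟩
  rw [← hβ, map_mul]

/-- The units ±i are impossible, because r² has even imaginary part while 1 + 2A has odd real part;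
the unit -1 is the square of i. -/
lemma exists_sq_of_isUnit {ε r A : GaussianInt} (hε : IsUnit ε) (h : r ^ 2 * ε = 1 + 2 * A) :
    ∃ s, s ^ 2 = 1 + 2 * A := by
  have h1 : ε.norm = 1 := by
    have := Zsqrtd.norm_eq_one_iff.2 hε
    have h0 := GaussianInt.norm_nonneg ε
    omega
  obtain ⟨p, q⟩ := ε
  obtain ⟨m, n⟩ := r
  have h2 : p * p + q * q = 1 := by
    rw [Zsqrtd.norm_def] at h1
    linarith
  have hp : p ≤ 1 := by nlinarith
  have hp' : -1 ≤ p := by nlinarith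
  have hq : q ≤ 1 := by nlinarith
  have hq' : -1 ≤ q := by nlinarith
  have hre := congrArg Zsqrtd.re h
  simp only [pow_two, Zsqrtd.re_mul, Zsqrtd.im_mul, Zsqrtd.re_add, Zsqrtd.re_one,
    Zsqrtd.re_ofNat, Zsqrtd.im_ofNat] at hre
  rw [← h]
  have hp0 : p ≠ 0 := by
    rintro rfl
    push_cast at hre
    exact absurd (show Even (1 : ℤ) from ⟨-(m * n * q) - A.re, by linarith⟩) (by decide)
  have hq0 : q = 0 := by interval_cases q <;> interval_cases p <;> simp_all
  subst hq0
  have : p = 1 ∨ p = -1 := by interval_cases p <;> simp_all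
  rcases this with rfl | rfl
  · refine ⟨⟨m, n⟩, ?_⟩
    ext <;> simp [pow_two]
  · refine ⟨⟨-n, m⟩, ?_⟩
    ext <;> simp [pow_two]

/-- The squares a² and c² are coprime Gaussian integers whose product is the square (ac)². So a² is
a unit times a square, and being 1 modulo 2 it is itself a square; hence a is integral. The other
entries are quotients by a with integral squares. -/
lemma entries_mem_ZI {a b c d : ℂ} (hdet : a * d - b * c = 1)
    (ha : ∃ A : GaussianInt, a ^ 2 = 1 + 2 * A) (hb : b ^ 2 ∈ ZI) (hc : c ^ 2 ∈ ZI)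
    (hd : d ^ 2 ∈ ZI) (hab : a * b ∈ ZI) (hac : a * c ∈ ZI) (had : a * d ∈ ZI)
    (hbd : b * d ∈ ZI) : a ∈ ZI ∧ b ∈ ZI ∧ c ∈ ZI ∧ d ∈ ZI := by
  have haZ : a ∈ ZI := by
    obtain ⟨A, hA⟩ := ha
    obtain ⟨B, hB⟩ := hb
    obtain ⟨C, hC⟩ := hc
    obtain ⟨D, hD⟩ := hd
    obtain ⟨S, hS⟩ := hac
    obtain ⟨T, hT⟩ := hbd
    have hA' : ((1 + 2 * A : GaussianInt) : ℂ) = a ^ 2 := by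
      rw [hA, map_add, map_mul, map_one, map_ofNat]
    have hmul : (1 + 2 * A) * C = S ^ 2 := by
      apply GaussianInt.toComplex_injective
      rw [map_mul, map_pow, hA', hC, hS]
      ring
    have hcop : IsCoprime (1 + 2 * A) C := by
      -- X = a²d² + b²c² lies in the ideal (a², c²), and the squared determinant gives X = 1 + 2ST
      -- with S = ac, T = bd. Then X(2 - X) = 1 - 4S²T² and S² = a²c², which is a Bézout relation.
      set X := (1 + 2 * A) * D + C * B with hX
      have hX' : X - 2 * (S * T) = 1 := by
        apply GaussianInt.toComplex_injective
        rw [hX]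
        simp only [map_sub, map_add (GaussianInt.toComplex) (_ * _) (_ * _), map_mul, map_one,
          map_ofNat, hA', hB, hC, hD, hS, hT]
        linear_combination (a * d - b * c + 1) * hdet
      refine ⟨D * (2 - X) + 4 * C * T ^ 2, B * (2 - X), ?_⟩
      linear_combination -(2 - X) * hX + 4 * T ^ 2 * hmul - (2 * S * T + X - 1) * hX'
    obtain ⟨r, ε, hε⟩ := exists_associated_pow_of_mul_eq_pow' hcop hmul
    obtain ⟨s, hs⟩ := exists_sq_of_isUnit ε.isUnit hε
    have : a ^ 2 = (s : ℂ) ^ 2 := by rw [← hA', ← hs, map_pow]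
    rcases sq_eq_sq_iff_eq_or_eq_neg.1 this with h | h
    · exact ⟨s, h.symm⟩
    · exact ⟨-s, by rw [map_neg, h]⟩
  have ha0 : a ≠ 0 := by
    rintro rfl
    obtain ⟨A, hA⟩ := ha
    have h0 : 1 + 2 * A = 0 := by
      apply GaussianInt.toComplex_injective
      rw [map_add, map_mul, map_one, map_ofNat, map_zero, ← hA]
      ring
    have hre := congrArg Zsqrtd.re h0
    simp only [Zsqrtd.re_mul, Zsqrtd.re_add, Zsqrtd.re_one, Zsqrtd.re_ofNat, Zsqrtd.im_ofNat,
      Zsqrtd.re_zero] at hre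
    push_cast at hre
    omega
  exact ⟨haZ, mem_ZI_of_mul_mem haZ ha0 hab hb, mem_ZI_of_mul_mem haZ ha0 hac hc,
    mem_ZI_of_mul_mem haZ ha0 had hd⟩

/-- The elements of `Γ` whose image in `SO(3, ℤ[i])` is congruent to `1` modulo `4` lie in
`SL(2, ℤ[i])`. -/
lemma mem_SL2Zi_of_congr_one {g : SpecialLinearGroup (Fin 2) ℂ}
    (h : ∀ i j, ∃ k : GaussianInt, (conjHom g).1 i j = (1 : Matrix (Fin 3) (Fin 3) ℂ) i j + 4 * k) :
    g ∈ SL2Zi := by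
  have hdet := det_eq_one g
  rw [conjHom_matrix] at h
  choose k hk using h
  have h00 := hk 0 0
  have h01 := hk 0 1
  have h02 := hk 0 2
  have h10 := hk 1 0
  have h11 := hk 1 1
  have h12 := hk 1 2
  have h20 := hk 2 0
  have h21 := hk 2 1
  have h22 := hk 2 2
  simp only [Matrix.of_apply, Matrix.cons_val, Matrix.one_apply_eq]
    at h00 h11 h22 h01 h02 h10 h12 h20 h21
  rw [Matrix.one_apply_ne (by decide)] at h01 h02 h10 h12 h20 h21
  rw [mem_SL2Zi_iff, Fin.forall_fin_two, Fin.forall_fin_two, Fin.forall_fin_two]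
  generalize g 0 0 = a at *
  generalize g 0 1 = b at *
  generalize g 1 0 = c at *
  generalize g 1 1 = d at *
  have hI := Complex.I_sq
  have hIk : ((⟨0, 1⟩ : GaussianInt) : ℂ) = Complex.I := by simp [GaussianInt.toComplex_def]
  generalize (⟨0, 1⟩ : GaussianInt) = ι at hIk
  obtain ⟨ha, hb, hc, hd⟩ : a ∈ ZI ∧ b ∈ ZI ∧ c ∈ ZI ∧ d ∈ ZI := by
    -- The squares and products of a, b, c, d are half-sums of matrix entries, with coefficients
    -- that are units. The halving turns the congruence modulo 4 into one modulo 2, as needed for a²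
    -- = 1 + 2A.
    refine entries_mem_ZI hdet ⟨k 0 0 - ι * k 0 1 + ι * k 1 0 + k 1 1, ?_⟩
      ⟨2 * (k 1 1 - ι * k 0 1 - k 0 0 - ι * k 1 0), ?_⟩
      ⟨2 * (k 1 1 + ι * k 0 1 - k 0 0 + ι * k 1 0), ?_⟩
      ⟨1 + 2 * (k 1 1 + ι * k 0 1 + k 0 0 - ι * k 1 0), ?_⟩
      ⟨-2 * (ι * k 1 2 + k 0 2), ?_⟩ ⟨2 * (ι * k 2 1 - k 2 0), ?_⟩ ⟨1 + 2 * k 2 2, ?_⟩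
      ⟨2 * (ι * k 2 1 + k 2 0), ?_⟩ <;>
      simp only [map_add, map_sub, map_mul, map_neg, map_one, map_ofNat, hIk]
    · linear_combination (h00 + h11 - Complex.I * h01 + Complex.I * h10) / 2
        + (a ^ 2 - d ^ 2) / 2 * hI
    · linear_combination (-h11 + Complex.I * h01 + h00 + Complex.I * h10) / 2
        - (b ^ 2 - c ^ 2) / 2 * hI
    · linear_combination (-h11 - Complex.I * h01 + h00 - Complex.I * h10) / 2
        + (b ^ 2 - c ^ 2) / 2 * hI
    · linear_combination (-h11 - Complex.I * h01 - h00 + Complex.I * h10) / 2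
        + (a ^ 2 - d ^ 2) / 2 * hI
    · linear_combination (Complex.I * h12 + h02) / 2 - (a * b + c * d) / 2 * hI
    · linear_combination (-Complex.I * h21 + h20) / 2 - (b * d + a * c) / 2 * hI
    · linear_combination (-h22 - hdet) / 2
    · linear_combination (-Complex.I * h21 - h20) / 2 - (b * d + a * c) / 2 * hI
  exact ⟨⟨ha, hb⟩, hc, hd⟩

lemma SL2Zi_relIndex_Gam_ne_zero : SL2Zi.relIndex Gam ≠ 0 := by
  apply relIndex_ne_zero_of_invariant SL2Zi Gam
    (fun g (i j : Fin 3) => residue 4 ((conjHom g).1 i j))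
  intro x hx y hy h
  obtain ⟨hx1, hx2, -⟩ : conjHom x ∈ SO3Zi := hx
  obtain ⟨hy1, -⟩ : conjHom y ∈ SO3Zi := hy
  choose k hk using fun i j =>
    exists_eq_add_of_residue_eq (hx1 i j) (hy1 i j) (congrFun (congrFun h i) j)
  choose m hm using hx1
  apply mem_SL2Zi_of_congr_one
  intro i j
  have hy2 : (conjHom y).1 = (conjHom x).1 + (4 : ℂ) • Matrix.of fun i j => (k i j : ℂ) := by
    ext i j
    simpa using hk i j
  have hinv : (conjHom x⁻¹).1 = (conjHom x).1ᵀ := by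
    rw [map_inv]
    exact Units.inv_eq_of_mul_eq_one_right hx2
  -- For M = conj(x), conj(y) = M + 4K and M⁻¹ = Mᵗ, the image of x⁻¹y is 1 + 4MᵗK.
  refine ⟨∑ l, m l i * k l j, ?_⟩
  rw [map_mul, Units.val_mul, hinv, hy2, mul_add, mul_eq_one_comm.1 hx2, Matrix.mul_smul]
  simp [Matrix.mul_apply, hm]

lemma commensurable_Gam_SL2Zi : Subgroup.Commensurable Gam SL2Zi :=
  ⟨Gam_relIndex_SL2Zi_ne_zero, SL2Zi_relIndex_Gam_ne_zero⟩

/-! ### A criterion for exact fundamental domains -/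

/-- If γ₁p = γ₂q, then γ₂⁻¹γ₁ takes p into F and its inverse takes q into F, so for γ₁ ≠ γ₂ neither
p nor q can be interior. -/
lemma IsFundamentalDomain.of_interior {X : Type*} [TopologicalSpace X] {Γ : Subgroup (X ≃ₜ X)}
    {F : Set X} (hcover : ∀ x, ∃ γ ∈ Γ, γ x ∈ F)
    (hinter : ∀ γ ∈ Γ, γ ≠ 1 → ∀ x ∈ interior F, γ x ∉ F) : IsFundamentalDomain Γ F where
  cover := by
    refine Set.eq_univ_of_forall fun x => ?_
    obtain ⟨γ, hγ, hx⟩ := hcover x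
    exact Set.mem_biUnion (Γ.inv_mem hγ) ⟨γ x, hx, γ.symm_apply_apply x⟩
  inter := by
    have key : ∀ γ₁ ∈ Γ, ∀ γ₂ ∈ Γ, γ₁ ≠ γ₂ → ∀ p ∈ F, ∀ q ∈ F, γ₁ p = γ₂ q → p ∈ frontier F := by
      intro γ₁ h₁ γ₂ h₂ hne p hp q hq hpq
      refine ⟨subset_closure hp, fun hint => ?_⟩
      refine hinter (γ₂⁻¹ * γ₁) (Γ.mul_mem (Γ.inv_mem h₂) h₁)
        (fun h => hne (inv_mul_eq_one.1 h).symm) p hint ?_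
      have : (γ₂⁻¹ * γ₁) p = γ₂.symm (γ₁ p) := rfl
      rwa [this, hpq, γ₂.symm_apply_apply]
    rintro γ₁ h₁ γ₂ h₂ hne x ⟨⟨p, hp, rfl⟩, q, hq, hpq⟩
    exact ⟨⟨p, key γ₁ h₁ γ₂ h₂ hne p hp q hq hpq.symm, rfl⟩,
      q, key γ₂ h₂ γ₁ h₁ hne.symm q hq p hp hpq, hpq⟩

lemma exists_pos_mem_of_mem_interior {X : Type*} [TopologicalSpace X] {S : Set X} {f : ℝ → X}
    (hf : ContinuousAt f 0) (h : f 0 ∈ interior S) : ∃ t > 0, f t ∈ S := by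
  have h1 : ∀ᶠ t in nhds (0 : ℝ), f t ∈ S := hf (mem_interior_iff_mem_nhds.1 h)
  obtain ⟨t, ht, ht'⟩ := ((h1.filter_mono nhdsWithin_le_nhds).and
    (self_mem_nhdsWithin : Set.Ioi (0 : ℝ) ∈ nhdsWithin 0 (Set.Ioi 0))).exists
  exact ⟨t, ht', ht⟩

/-! ### The triangle and the affine maps t ↦ ut + β -/

lemma mem_triangle_iff (t : ℂ) : t ∈ triangle ↔ 1 ≤ t.re ∧ 0 ≤ t.im ∧ t.re + t.im ≤ 2 := by
  constructor
  · intro h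
    have hconv : Convex ℝ {t : ℂ | 1 ≤ t.re ∧ 0 ≤ t.im ∧ t.re + t.im ≤ 2} := by
      rintro p ⟨h1, h2, h3⟩ q ⟨k1, k2, k3⟩ a b ha hb hab
      refine ⟨?_, ?_, ?_⟩ <;> simp <;> nlinarith
    refine convexHull_min ?_ hconv h
    rintro p (rfl | rfl | rfl) <;> norm_num
  · rintro ⟨h1, h2, h3⟩
    have hc : Convex ℝ triangle := convex_convexHull ℝ _
    have hsub : ({1, 2, 1 + Complex.I} : Set ℂ) ⊆ triangle := subset_convexHull ℝ _
    have := hc.sum_mem (t := Finset.univ) (w := ![2 - t.re - t.im, t.re - 1, t.im])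
      (z := ![1, 2, 1 + Complex.I]) (by
        intro i _
        fin_cases i <;> simp <;> linarith) (by
        simp [Fin.sum_univ_three]
        ring)
      (by
        intro i _
        fin_cases i <;> apply hsub <;> simp)
    convert this using 1
    apply Complex.ext
    · simp [Fin.sum_univ_three]
      ring
    · simp [Fin.sum_univ_three]

lemma of_mem_interior_triangle {t : ℂ} (h : t ∈ interior triangle) :
    1 < t.re ∧ 0 < t.im ∧ t.re + t.im < 2 := by
  have key : ∀ v : ℂ, ∃ s > (0 : ℝ), t + s * v ∈ triangle := fun v =>
    exists_pos_mem_of_mem_interior (f := fun s : ℝ => t + s * v) (by fun_prop) (by simpa using h)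
  obtain ⟨r, hr, h1⟩ := key (-1)
  obtain ⟨s, hs, h2⟩ := key (-Complex.I)
  obtain ⟨q, hq, h3⟩ := key 1
  rw [mem_triangle_iff] at h1 h2 h3
  simp at h1 h2 h3
  exact ⟨by linarith, by linarith, by linarith⟩

lemma triangle_eq_closure_interior : triangle = closure (interior triangle) := by
  have hc : Convex ℝ triangle := convex_convexHull ℝ _
  have hclosed : IsClosed triangle := by
    have : triangle = {t : ℂ | 1 ≤ t.re ∧ 0 ≤ t.im ∧ t.re + t.im ≤ 2} :=
      Set.ext mem_triangle_iff
    rw [this]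
    have h1 := Complex.continuous_re
    have h2 := Complex.continuous_im
    exact (isClosed_le continuous_const h1).inter ((isClosed_le continuous_const h2).inter
      (isClosed_le (h1.add h2) continuous_const))
  have hne : (interior triangle).Nonempty := by
    refine ⟨⟨5 / 4, 1 / 4⟩, mem_interior.2
      ⟨{t : ℂ | 1 < t.re ∧ 0 < t.im ∧ t.re + t.im < 2}, ?_, ?_, by norm_num⟩⟩
    · rintro t ⟨h1, h2, h3⟩
      exact (mem_triangle_iff t).2 ⟨h1.le, h2.le, h3.le⟩
    · have h1 := Complex.continuous_re
      have h2 := Complex.continuous_im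
      exact (isOpen_lt continuous_const h1).inter ((isOpen_lt continuous_const h2).inter
        (isOpen_lt (h1.add h2) continuous_const))
  rw [hc.closure_interior_eq_closure_of_nonempty_interior hne, hclosed.closure_eq]

/-- Rounding in the basis 1 + i, -1 + i of the even lattice moves t into the square with centre 1
and vertices 1 ± 1, 1 ± i. A quarter-turn multiple about 1 then moves its quadrant to the triangle;
its translation part 1 - u is even. -/
lemma exists_affine_mem_triangle (t : ℂ) : ∃ u β : GaussianInt,
    u.norm = 1 ∧ Even (β.re + β.im) ∧ u * t + β ∈ triangle := by
  obtain ⟨k, hk⟩ : ∃ k : ℤ, |(t.re - 1 + t.im) / 2 - k| ≤ 1 / 2 := ⟨_, abs_sub_round _⟩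
  obtain ⟨l, hl⟩ : ∃ l : ℤ, |(t.im - (t.re - 1)) / 2 - l| ≤ 1 / 2 := ⟨_, abs_sub_round _⟩
  rw [abs_le] at hk hl
  obtain ⟨hk1, hk2⟩ := hk
  obtain ⟨hl1, hl2⟩ := hl
  rcases le_total 0 (t.re - 1 - (k - l)) with hp | hp <;>
    rcases le_total 0 (t.im - (k + l)) with hq | hq
  · refine ⟨1, ⟨-(k - l), -(k + l)⟩, by simp, ⟨-k, by ring⟩, (mem_triangle_iff _).2 ?_⟩
    simp [GaussianInt.toComplex_def]
    refine ⟨?_, ?_, ?_⟩ <;> linarith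
  · refine ⟨⟨0, 1⟩, ⟨1 + (k + l), -1 - (k - l)⟩, by simp [Zsqrtd.norm_def], ⟨l, by ring⟩,
      (mem_triangle_iff _).2 ?_⟩
    simp [GaussianInt.toComplex_def]
    refine ⟨?_, ?_, ?_⟩ <;> linarith
  · refine ⟨⟨0, -1⟩, ⟨1 - (k + l), 1 + (k - l)⟩, by simp [Zsqrtd.norm_def], ⟨1 - l, by ring⟩,
      (mem_triangle_iff _).2 ?_⟩
    simp [GaussianInt.toComplex_def]
    refine ⟨?_, ?_, ?_⟩ <;> linarith
  · refine ⟨-1, ⟨2 + (k - l), k + l⟩, by simp, ⟨1 + k, by ring⟩, (mem_triangle_iff _).2 ?_⟩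
    simp [GaussianInt.toComplex_def]
    refine ⟨?_, ?_, ?_⟩ <;> linarith

/-- For each unit u the strict inequalities at t bound β. They are contradictory for u = -1, force β
= 0 for u = 1, and for u = ±i leave only one β, which is odd. -/
lemma affine_eq_id_of_mem_triangle {t : ℂ} (ht : t ∈ interior triangle) {u β : GaussianInt}
    (hu : u.norm = 1) (hβ : Even (β.re + β.im)) (h : u * t + β ∈ triangle) : u = 1 ∧ β = 0 := by
  obtain ⟨h1, h2, h3⟩ := of_mem_interior_triangle ht
  rw [mem_triangle_iff] at h
  obtain ⟨p, q⟩ := u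
  obtain ⟨m, n⟩ := β
  replace hu : p * p + q * q = 1 := by
    rw [Zsqrtd.norm_def] at hu
    linarith
  have hp : p ≤ 1 := by nlinarith
  have hp' : -1 ≤ p := by nlinarith
  have hq : q ≤ 1 := by nlinarith
  have hq' : -1 ≤ q := by nlinarith
  obtain ⟨k, hk⟩ := hβ
  simp only [GaussianInt.toComplex_def, Complex.add_re, Complex.mul_re, Complex.add_im,
    Complex.mul_im, Complex.intCast_re, Complex.intCast_im, Complex.I_re, Complex.I_im] at h
  obtain ⟨k1, k2, k3⟩ := h
  have hcast : ∀ a b : ℤ, (a : ℝ) < b + 1 → a ≤ b := fun a b hab =>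
    Int.lt_add_one_iff.1 (by exact_mod_cast hab)
  simp only at hk
  have hmn : (m : ℝ) + n = k + k := by exact_mod_cast hk
  interval_cases p <;> interval_cases q <;> first | (exfalso; omega) | skip
  · exfalso
    push_cast at k1 k2 k3
    have := hcast 3 m (by push_cast; linarith)
    have := hcast 1 n (by push_cast; linarith)
    have := hcast (m + n) 3 (by push_cast; linarith)
    omega
  · exfalso
    push_cast at k1 k2 k3
    have := hcast 1 m (by push_cast; linarith)
    have := hcast 2 n (by push_cast; linarith)
    have := hcast (m + n) 3 (by push_cast; linarith)
    omega
  · exfalso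
    push_cast at k1 k2 k3
    have := hcast 2 m (by push_cast; linarith)
    have := hcast (-1) n (by push_cast; linarith)
    have := hcast (m + n) 1 (by push_cast; linarith)
    omega
  · push_cast at k1 k2 k3
    have := hcast 0 m (by push_cast; linarith)
    have := hcast 0 n (by push_cast; linarith)
    have := hcast (m + n) 0 (by push_cast; linarith)
    have hm : m = 0 := by omega
    have hn : n = 0 := by omega
    subst hm hn
    exact ⟨rfl, rfl⟩

/-! ### The stabiliser of the height -/

lemma smul_of_lower_left_eq_zero {g : SpecialLinearGroup (Fin 2) ℂ} (hc : g 1 0 = 0)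
    {u : GaussianInt} (hu : u.norm = 1) (ha : g 0 0 ^ 2 = u) (z : H3) :
    (g • z).x = u * z.x + g 0 0 * g 0 1 ∧ (g • z).y = z.y := by
  have hdet := det_eq_one g
  rw [hc, mul_zero, sub_zero] at hdet
  have ha1 : Complex.normSq (g 0 0) = 1 := by
    have h := congrArg Complex.normSq ha
    rw [map_pow, ← GaussianInt.intCast_real_norm, hu, Int.cast_one] at h
    exact (pow_eq_one_iff_of_nonneg (Complex.normSq_nonneg _) two_ne_zero).1 h
  have hd1 : Complex.normSq (g 1 1) = 1 := by
    have h := congrArg Complex.normSq hdet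
    rwa [map_mul, ha1, one_mul, map_one] at h
  have hden : den g z = 1 := by simp [den, hc, hd1]
  have hconj : conj (g 1 1) = g 0 0 := by
    have h : g 1 1 * conj (g 1 1) = 1 := by rw [Complex.mul_conj, hd1, Complex.ofReal_one]
    linear_combination g 0 0 * h - conj (g 1 1) * hdet
  constructor
  · rw [x_smul, hden, hc, zero_mul, zero_add, hconj, ← ha]
    simp
    ring
  · rw [y_smul, hden, div_one]

/-- The elements of `Γ` that fix `∞` act by `(x, y) ↦ (u x + β, y)`. -/
lemma exists_affine_smul {g : SpecialLinearGroup (Fin 2) ℂ} (hg : g ∈ Gam) (hc : g 1 0 = 0) :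
    ∃ u β : GaussianInt, u.norm = 1 ∧ Even (β.re + β.im) ∧
      ∀ z : H3, (g • z).x = u * z.x + β ∧ (g • z).y = z.y := by
  have h := (mem_Gam_iff g).1 hg
  have hdet := det_eq_one g
  rw [hc, mul_zero, sub_zero] at hdet
  rw [hc] at h
  obtain ⟨u, β, hu, hβ, ha, hb⟩ := h.exists_affine hdet
  refine ⟨u, β, hu, hβ, fun z => ?_⟩
  rw [← hb]
  exact smul_of_lower_left_eq_zero hc hu ha z

lemma phi1_le_phi1_iff {z w : H3} :
    phi1 z ≤ phi1 w ↔ w.y ≤ z.y := by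
  unfold phi1
  rw [neg_le_neg_iff, Real.log_le_log_iff w.y_pos z.y_pos]

/-- Preserving heights makes every denominator 1; at j and 2j this reads |d|² + |c|² = |d|² + 4|c|².
-/
lemma lower_left_eq_zero_of_mem_stabPhi1 {Γ : Subgroup (SpecialLinearGroup (Fin 2) ℂ)}
    {g : SpecialLinearGroup (Fin 2) ℂ} (hg : g ∈ stabPhi1 Γ) : g 1 0 = 0 := by
  have hden : ∀ z : H3, den g z = 1 := by
    intro z
    have h := phi1_inj.1 (hg.2 z)
    rw [y_smul, div_eq_iff (den_pos g z).ne'] at h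
    exact (mul_right_eq_self₀.1 h.symm).resolve_right z.y_pos.ne'
  have h1 := hden ⟨(0, 1), one_pos⟩
  have h2 := hden ⟨(0, 2), two_pos⟩
  unfold den H3.x H3.y at h1 h2
  apply Complex.normSq_eq_zero.1
  simp only at h1 h2
  linarith

lemma mem_stabPhi1_Gam_iff {g : SpecialLinearGroup (Fin 2) ℂ} :
    g ∈ stabPhi1 Gam ↔ g ∈ Gam ∧ g 1 0 = 0 := by
  refine ⟨fun h => ⟨h.1, lower_left_eq_zero_of_mem_stabPhi1 h⟩, fun h => ⟨h.1, fun z => ?_⟩⟩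
  obtain ⟨u, β, -, -, hz⟩ := exists_affine_smul h.1 h.2
  exact phi1_inj.2 (hz z).2

lemma exists_mem_stabPhi1_smul_mem_triangle (t : ℂ) :
    ∃ g ∈ stabPhi1 Gam, ∀ z : H3, z.x = t → (g • z).x ∈ triangle := by
  obtain ⟨u, β, hu, hβ, ht⟩ := exists_affine_mem_triangle t
  obtain ⟨g, hg, hc, ha, hb⟩ := exists_mem_Gam_affine hu hβ
  refine ⟨g, mem_stabPhi1_Gam_iff.2 ⟨hg, hc⟩, fun z hz => ?_⟩
  rwa [(smul_of_lower_left_eq_zero hc hu ha z).1, hb, hz]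

lemma smul_eq_self_of_mem_triangle {g : SpecialLinearGroup (Fin 2) ℂ} (hg : g ∈ stabPhi1 Gam)
    {z : H3} (hz : z.x ∈ interior triangle) (hgz : (g • z).x ∈ triangle) (w : H3) : g • w = w := by
  rw [mem_stabPhi1_Gam_iff] at hg
  obtain ⟨u, β, hu, hβ, h⟩ := exists_affine_smul hg.1 hg.2
  rw [(h z).1] at hgz
  obtain ⟨rfl, rfl⟩ := affine_eq_id_of_mem_triangle hz hu hβ hgz
  exact H3.ext' (by simp [(h w).1]) (h w).2

lemma isFundamentalDomain_triangle : IsFundamentalDomain (inducedAct Gam).range triangle := by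
  apply IsFundamentalDomain.of_interior
  · intro t
    obtain ⟨g, hg, h⟩ := exists_mem_stabPhi1_smul_mem_triangle t
    exact ⟨_, ⟨⟨g, hg⟩, rfl⟩, h (section23 t) rfl⟩
  · rintro _ ⟨⟨g, hg⟩, rfl⟩ hne t ht hgt
    apply hne
    ext1 s
    change phi23 (g • section23 s) = s
    rw [smul_eq_self_of_mem_triangle hg (z := section23 t) ht hgt]
    rfl

/-! ### The part of the height-maximal set over the triangle -/

/-- The points over the triangle on or outside the sphere of centre `1` and radius `√2`. -/
def domain : Set H3 := {z | z.x ∈ triangle ∧ 2 ≤ ‖z.x - 1‖ ^ 2 + z.y ^ 2}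

lemma phi1_le_phi1_smul_iff {g : SpecialLinearGroup (Fin 2) ℂ} {z : H3} :
    phi1 z ≤ phi1 (g • z) ↔ 1 ≤ den g z := by
  rw [phi1_le_phi1_iff, y_smul, div_le_iff₀ (den_pos g z), le_mul_iff_one_le_right z.y_pos]

lemma sq_norm_sub_one (t : ℂ) : ‖t - 1‖ ^ 2 = (t.re - 1) ^ 2 + t.im ^ 2 := by
  rw [Complex.sq_norm, Complex.normSq_apply]
  simp
  ring

lemma sq_norm_sub_one_le {t : ℂ} (ht : t ∈ triangle) : ‖t - 1‖ ^ 2 ≤ 1 := by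
  rw [mem_triangle_iff] at ht
  rw [sq_norm_sub_one]
  nlinarith

/-- Among the odd Gaussian integers, `1` is nearest to the points of the triangle. -/
lemma sq_norm_sub_one_le_normSq_add {t : ℂ} (ht : t ∈ triangle) {δ : GaussianInt}
    (hδ : Odd (δ.re + δ.im)) : ‖t - 1‖ ^ 2 ≤ Complex.normSq (t + δ) := by
  obtain ⟨h1, h2, h3⟩ := (mem_triangle_iff t).1 ht
  -- The expression is |m + ni + 1|² - 1, which is negative only at -1, an odd point.
  have key : ∀ m n : ℤ, Even (m + n) → (0 : ℝ) ≤ (m : ℝ) ^ 2 + n ^ 2 + 2 * m := by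
    intro m n hmn
    have : 0 ≤ m ^ 2 + n ^ 2 + 2 * m := by
      by_contra! h
      have hm : m = -1 := by nlinarith [sq_nonneg n, sq_nonneg (m + 1)]
      have hn : n = 0 := by
        subst hm
        nlinarith
      subst hm hn
      exact absurd hmn (by decide)
    exact_mod_cast this
  have k1 := key (δ.re + 1) δ.im (by
    rw [add_right_comm]
    exact hδ.add_one)
  have k2 := key δ.im (δ.re + 1) (by
    rw [add_comm δ.im, add_right_comm]
    exact hδ.add_one)
  -- With D = δ + 1, the difference |t + δ|² - |t - 1|² is affine in t, so it is the barycentric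
  -- mean of its values |D|², |D|² + 2 Re D and |D|² + 2 Im D at the vertices; all three are
  -- nonnegative.
  have e1 := mul_nonneg (sub_nonneg.2 h1) k1
  have e2 := mul_nonneg h2 k2
  have e3 := mul_nonneg (sub_nonneg.2 h3)
    (add_nonneg (sq_nonneg ((δ.re : ℝ) + 1)) (sq_nonneg (δ.im : ℝ)))
  rw [sq_norm_sub_one, Complex.normSq_apply]
  simp only [GaussianInt.toComplex_def, Complex.add_re, Complex.mul_re, Complex.add_im,
    Complex.mul_im, Complex.intCast_re, Complex.intCast_im, Complex.I_re, Complex.I_im]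
  push_cast at e1 e2
  linarith

lemma half_le_den {g : SpecialLinearGroup (Fin 2) ℂ} (hg : g ∈ Gam) (hc : g 1 0 ≠ 0) {z : H3}
    (hz : z.x ∈ triangle) :
    (‖z.x - 1‖ ^ 2 + z.y ^ 2) / 2 ≤ den g z ∨ z.y ^ 2 ≤ den g z := by
  have hdet := det_eq_one g
  rcases ((mem_Gam_iff g).1 hg).normSq_lower_left hdet hc with ⟨h, δ, hδ, hd⟩ | h
  · left
    have h1 := sq_norm_sub_one_le_normSq_add hz hδ
    have h2 : g 1 0 * z.x + g 1 1 = g 1 0 * (z.x + δ) := by rw [hd]; ring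
    rw [den, h2, map_mul, h]
    linarith
  · right
    have h1 := Complex.normSq_nonneg (g 1 0 * z.x + g 1 1)
    have h2 := sq_nonneg z.y
    rw [den]
    nlinarith

/-- On or outside the sphere, either bound of `half_le_den` is at least 1, the second because |x -
1| ≤ 1 over the triangle. Conversely, the element with isometric sphere of centre 1 and radius √2
excludes all points inside it. -/
lemma domain_eq : domain = phi23 ⁻¹' triangle ∩ F1 Gam := by
  ext z
  constructor
  · rintro ⟨h1, h2⟩
    refine ⟨h1, fun g hg => phi1_le_phi1_smul_iff.2 ?_⟩
    have h3 := sq_norm_sub_one_le h1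
    by_cases hc : g 1 0 = 0
    · obtain ⟨u, β, -, -, h⟩ := exists_affine_smul hg hc
      exact phi1_le_phi1_smul_iff.1 (phi1_le_phi1_iff.2 (h z).2.le)
    · rcases half_le_den hg hc h1 with h | h <;> linarith
  · rintro ⟨h1, h2⟩
    obtain ⟨g, hg, hd, hc⟩ := exists_mem_Gam_isometric_sphere
    have h := phi1_le_phi1_smul_iff.1 (h2 g hg)
    have h3 : g 1 0 * z.x + -g 1 0 = g 1 0 * (z.x - 1) := by ring
    rw [den, hd, h3, map_mul, hc, ← Complex.sq_norm] at h
    exact ⟨h1, by linarith⟩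

lemma of_mem_interior_domain {z : H3} (hz : z ∈ interior domain) :
    z.x ∈ interior triangle ∧ 2 < ‖z.x - 1‖ ^ 2 + z.y ^ 2 := by
  constructor
  · let f : ℂ → H3 := fun t => ⟨(t, z.y), z.y_pos⟩
    have hf : Continuous f := Continuous.subtype_mk (by fun_prop) _
    exact mem_interior.2 ⟨f ⁻¹' interior domain, fun t ht => (interior_subset ht).1,
      isOpen_interior.preimage hf, hz⟩
  -- Lower the point slightly while keeping x fixed; the exponential factor keeps the path in `H3`
  -- for every real parameter.
  · let f : ℝ → H3 := fun t => ⟨(z.x, z.y * Real.exp (-t)), mul_pos z.y_pos (Real.exp_pos _)⟩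
    have hf : Continuous f := Continuous.subtype_mk (by fun_prop) _
    have hf0 : f 0 = z := H3.ext' rfl (by simp [f, H3.y])
    obtain ⟨t, ht, -, h⟩ := exists_pos_mem_of_mem_interior hf.continuousAt (hf0.symm ▸ hz)
    refine h.trans_lt ?_
    have h1 : Real.exp (-t) < 1 := Real.exp_zero ▸ Real.exp_lt_exp.2 (neg_lt_zero.2 ht)
    have h2 : (f t).y < z.y := mul_lt_of_lt_one_right z.y_pos h1
    have h3 : (f t).y ^ 2 < z.y ^ 2 := pow_lt_pow_left₀ h2 (f t).y_pos.le two_ne_zero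
    exact add_lt_add_right h3 _

/-! ### Existence of a point of maximal height in an orbit -/

lemma finite_norm_le (R : ℝ) : {w : GaussianInt | Complex.normSq w ≤ R}.Finite := by
  refine (((Set.finite_Icc (-⌈R⌉) ⌈R⌉).prod (Set.finite_Icc (-⌈R⌉) ⌈R⌉)).image
    fun p : ℤ × ℤ => (⟨p.1, p.2⟩ : GaussianInt)).subset ?_
  rintro ⟨m, n⟩ h
  rw [Set.mem_ofPred_eq, ← GaussianInt.intCast_real_norm] at h
  have h' : (⟨m, n⟩ : GaussianInt).norm ≤ ⌈R⌉ := by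
    exact_mod_cast h.trans (Int.le_ceil R)
  rw [Zsqrtd.norm_def] at h'
  simp only at h'
  have hk : ∀ k : ℤ, k ≤ k * k ∧ -k ≤ k * k := by
    intro k
    have h1 := Int.le_self_sq k
    have h2 := Int.le_self_sq (-k)
    constructor <;> linarith
  refine ⟨(m, n), ⟨⟨?_, ?_⟩, ?_, ?_⟩, rfl⟩ <;> simp only <;>
    linarith [(hk m).1, (hk m).2, (hk n).1, (hk n).2, mul_self_nonneg m, mul_self_nonneg n]

/-- The denominator depends only on (2c², 2cd, 2d²), which for elements of Γ are Gaussian integers;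
this supplies the discreteness. -/
lemma den_eq_of_forms (g : SpecialLinearGroup (Fin 2) ℂ) (z : H3) :
    den g z = (‖2 * g 1 0 ^ 2 * z.x ^ 2 + 2 * (2 * g 1 0 * g 1 1) * z.x + 2 * g 1 1 ^ 2‖
      + ‖2 * g 1 0 ^ 2‖ * z.y ^ 2) / 2 := by
  have h1 : 2 * g 1 0 ^ 2 * z.x ^ 2 + 2 * (2 * g 1 0 * g 1 1) * z.x + 2 * g 1 1 ^ 2 =
      2 * (g 1 0 * z.x + g 1 1) ^ 2 := by ring
  rw [h1, norm_mul, norm_mul, norm_pow, norm_pow, Complex.sq_norm, Complex.sq_norm, den]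
  simp
  ring

/-- Only finitely many triples (2c², 2cd, 2d²) have denominator at most 1, and the identity supplies
one, so a minimum is attained. -/
lemma exists_den_le (z : H3) : ∃ g ∈ Gam, ∀ g' ∈ Gam, den g z ≤ den g' z := by
  let H : GaussianInt × GaussianInt × GaussianInt → ℝ := fun τ =>
    (‖(τ.1 : ℂ) * z.x ^ 2 + 2 * τ.2.1 * z.x + τ.2.2‖ + ‖(τ.1 : ℂ)‖ * z.y ^ 2) / 2
  let S : Set (GaussianInt × GaussianInt × GaussianInt) := {τ | ∃ g ∈ Gam, den g z ≤ 1 ∧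
    (τ.1 : ℂ) = 2 * g 1 0 ^ 2 ∧ (τ.2.1 : ℂ) = 2 * g 1 0 * g 1 1 ∧ (τ.2.2 : ℂ) = 2 * g 1 1 ^ 2}
  have hH : ∀ (g : SpecialLinearGroup (Fin 2) ℂ) (τ : GaussianInt × GaussianInt × GaussianInt),
      (τ.1 : ℂ) = 2 * g 1 0 ^ 2 → (τ.2.1 : ℂ) = 2 * g 1 0 * g 1 1 →
      (τ.2.2 : ℂ) = 2 * g 1 1 ^ 2 → H τ = den g z := by
    intro g τ h1 h2 h3
    simp only [H, h1, h2, h3]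
    rw [den_eq_of_forms]
  have hex : ∀ g ∈ Gam, ∃ τ : GaussianInt × GaussianInt × GaussianInt,
      (τ.1 : ℂ) = 2 * g 1 0 ^ 2 ∧ (τ.2.1 : ℂ) = 2 * g 1 0 * g 1 1 ∧
        (τ.2.2 : ℂ) = 2 * g 1 1 ^ 2 := by
    intro g hg
    have h := (mem_Gam_iff g).1 hg
    obtain ⟨p, hp⟩ := h.two_sq_left
    obtain ⟨q, hq⟩ := h.two_mul
    obtain ⟨s, hs⟩ := h.two_sq_right
    exact ⟨(p, q, s), hp, hq, hs⟩
  have hfin : S.Finite := by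
    -- A denominator at most 1 gives |c|² ≤ C from |c|²y² ≤ 1, and |d|² ≤ D from |d|² ≤ 2|cx + d|² +
    -- 2|cx|².
    set C := 1 / z.y ^ 2 with hC
    set D := 2 + 2 * C * Complex.normSq z.x with hD
    have hy : 0 < z.y ^ 2 := pow_pos z.y_pos 2
    have hC0 : 0 ≤ C := by positivity
    have hx0 := Complex.normSq_nonneg z.x
    have hD0 : 0 ≤ D := by positivity
    refine ((finite_norm_le (4 * (C * C))).prod ((finite_norm_le (4 * (C * D))).prod
      (finite_norm_le (4 * (D * D))))).subset ?_
    rintro ⟨p, q, s⟩ ⟨g, -, hden, hp, hq, hs⟩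
    simp only at hp hq hs
    have h4 : Complex.normSq 2 = 4 := by norm_num [Complex.normSq_apply]
    have hc0 := Complex.normSq_nonneg (g 1 0)
    have hd0 := Complex.normSq_nonneg (g 1 1)
    have hn0 := Complex.normSq_nonneg (g 1 0 * z.x + g 1 1)
    rw [den] at hden
    have hc : Complex.normSq (g 1 0) ≤ C := by
      rw [hC, le_div_iff₀ hy]
      linarith
    have hd : Complex.normSq (g 1 1) ≤ D := by
      have h1 : Complex.normSq (g 1 1) ≤ 2 * Complex.normSq (g 1 0 * z.x + g 1 1)
          + 2 * Complex.normSq (g 1 0 * z.x) := by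
        have h2 := Complex.normSq_nonneg (2 * (g 1 0 * z.x) + g 1 1)
        simp only [Complex.normSq_apply, Complex.add_re, Complex.add_im, Complex.re_ofNat,
          Complex.im_ofNat, Complex.mul_re 2, Complex.mul_im 2] at h2 ⊢
        linarith
      rw [map_mul] at h1
      have h3 : 0 ≤ Complex.normSq (g 1 0) * z.y ^ 2 := by positivity
      have h4 := mul_le_mul_of_nonneg_right hc hx0
      linarith
    refine ⟨?_, ?_, ?_⟩
    · change Complex.normSq p ≤ _
      rw [hp, map_mul, h4, pow_two, map_mul]
      gcongr
    · change Complex.normSq q ≤ _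
      rw [hq, mul_assoc, map_mul, h4, map_mul]
      gcongr
    · change Complex.normSq s ≤ _
      rw [hs, map_mul, h4, pow_two, map_mul]
      gcongr
  have hone : den 1 z = 1 := by simp [den]
  have hne : S.Nonempty := by
    obtain ⟨τ, hτ⟩ := hex 1 (one_mem _)
    exact ⟨τ, 1, one_mem _, hone.le, hτ⟩
  obtain ⟨τ, ⟨g, hg, hden, h1, h2, h3⟩, hmin⟩ := hfin.exists_minimalFor H S hne
  refine ⟨g, hg, fun g' hg' => ?_⟩
  by_cases h : den g' z ≤ 1
  · obtain ⟨τ', k1, k2, k3⟩ := hex g' hg'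
    rw [← hH g τ h1 h2 h3, ← hH g' τ' k1 k2 k3]
    exact (le_total (H τ) (H τ')).elim id (hmin ⟨g', hg', h, k1, k2, k3⟩)
  · linarith

lemma isFundamentalDomain_domain : IsFundamentalDomain (Gam.map H3.act) domain := by
  apply IsFundamentalDomain.of_interior
  · intro z
    obtain ⟨g, hg, hmin⟩ := exists_den_le z
    obtain ⟨s, hs, hx⟩ := exists_mem_stabPhi1_smul_mem_triangle (g • z).x
    -- First g maximises the height on the orbit; then s moves x into the triangle without changing
    -- the height.
    refine ⟨H3.act (s * g), ⟨s * g, mul_mem hs.1 hg, rfl⟩, ?_⟩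
    change (s * g) • z ∈ domain
    rw [domain_eq, mul_smul]
    refine ⟨hx _ rfl, fun γ hγ => ?_⟩
    rw [hs.2, ← mul_smul, ← mul_smul, phi1_le_phi1_iff, y_smul, y_smul]
    exact div_le_div_of_nonneg_left z.y_pos.le (den_pos _ z)
      (hmin _ (mul_mem (mul_mem hγ hs.1) hg))
  · rintro _ ⟨g, hg, rfl⟩ hne z hz hgz
    change g • z ∈ domain at hgz
    obtain ⟨hx, hlt⟩ := of_mem_interior_domain hz
    -- Since gz is itself height-maximal, comparing it with z = g⁻¹(gz) gives y(z) ≤ y(gz). For c ≠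
    -- 0 an interior point has denominator greater than 1.
    have hle : den g z ≤ 1 := by
      have h : g • z ∈ F1 Gam := (domain_eq ▸ hgz).2
      have h' := h g⁻¹ (inv_mem hg)
      rw [inv_smul_smul, phi1_le_phi1_iff, y_smul, le_div_iff₀ (den_pos g z)] at h'
      exact le_of_mul_le_mul_left (by linarith) z.y_pos
    have hx' := interior_subset hx
    by_cases hc : g 1 0 = 0
    · apply hne
      ext1 w
      exact smul_eq_self_of_mem_triangle (mem_stabPhi1_Gam_iff.2 ⟨hg, hc⟩) hx hgz.1 w
    · have h1 := sq_norm_sub_one_le hx'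
      rcases half_le_den hg hc hx' with h | h <;> linarith

lemma isGoodGrenierDomain_domain : IsGoodGrenierDomain Gam triangle domain where
  commensurable := commensurable_Gam_SL2Zi
  base := isFundamentalDomain_triangle
  base_eq := triangle_eq_closure_interior
  eq := domain_eq
  fundamental := isFundamentalDomain_domain

/-! ### Convex sets in the closure of `ℍ³` -/

/-- The closed region that lies on or above a hemisphere (for `0 < k`), or on one side of a
vertical plane (for `k = 0`), together with `∞`. -/
def upperRegion (u : ℂ) (k m : ℝ) : Set H3bar :=
  insert OnePoint.infty
    {w | ∃ z : HalfSpace, w = (z : H3bar) ∧ m ≤ (u * z.1.1).re + k * z.sqNorm}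

lemma infty_mem_upperRegion (u : ℂ) (k m : ℝ) : OnePoint.infty ∈ upperRegion u k m :=
  Set.mem_insert _ _

lemma coe_mem_upperRegion {u : ℂ} {k m : ℝ} {z : HalfSpace} :
    (z : H3bar) ∈ upperRegion u k m ↔ m ≤ (u * z.1.1).re + k * z.sqNorm := by
  constructor
  · rintro (h | ⟨w, hw, h⟩)
    · exact absurd h (OnePoint.coe_ne_infty z)
    · rwa [OnePoint.coe_injective hw]
  · exact fun h => Or.inr ⟨z, rfl, h⟩

/-- The defining inequality is affine in (x, |x|² + y²), along which finite segments are straight.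
The condition 0 ≤ k keeps the region stable under moving up, as rays to ∞ require. -/
lemma hypConvex_upperRegion (u : ℂ) {k : ℝ} (hk : 0 ≤ k) (m : ℝ) :
    HypConvex (upperRegion u k m) := by
  have hvert : ∀ p z : HalfSpace, (p : H3bar) ∈ upperRegion u k m → z.1.1 = p.1.1 →
      p.1.2 ≤ z.1.2 → (z : H3bar) ∈ upperRegion u k m := by
    intro p z hp hx hy
    rw [coe_mem_upperRegion] at hp ⊢
    refine hp.trans ?_
    have h : p.1.2 ^ 2 ≤ z.1.2 ^ 2 := pow_le_pow_left₀ p.2 hy 2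
    rw [HalfSpace.sqNorm, HalfSpace.sqNorm, hx]
    gcongr
  rintro (_ | p) hp (_ | q) hq w hw
  · rw [show w = OnePoint.infty from hw]
    exact infty_mem_upperRegion u k m
  · rcases hw with rfl | ⟨z, rfl, hx, hy⟩
    · exact infty_mem_upperRegion u k m
    · exact hvert q z hq hx hy
  · rcases hw with rfl | ⟨z, rfl, hx, hy⟩
    · exact infty_mem_upperRegion u k m
    · exact hvert p z hp hx hy
  · obtain ⟨z, rfl, s, ⟨h0, h1⟩, hx, hN⟩ := hw
    have hp' := coe_mem_upperRegion.1 hp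
    have hq' := coe_mem_upperRegion.1 hq
    rw [coe_mem_upperRegion, hx, hN]
    have e : (u * ((1 - s) * p.1.1 + s * q.1.1)).re =
        (1 - s) * (u * p.1.1).re + s * (u * q.1.1).re := by
      simp
      ring
    rw [e]
    have h2 := mul_le_mul_of_nonneg_left hp' (sub_nonneg.2 h1)
    have h3 := mul_le_mul_of_nonneg_left hq' h0
    linarith

lemma hypConvex_range_coe : HypConvex (Set.range ((↑) : HalfSpace → H3bar)) := by
  rintro _ ⟨p, rfl⟩ _ ⟨q, rfl⟩ w ⟨z, rfl, -⟩
  exact ⟨z, rfl⟩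

lemma HypConvex.inter {C D : Set H3bar} (hC : HypConvex C) (hD : HypConvex D) :
    HypConvex (C ∩ D) :=
  fun p hp q hq _ hw => ⟨hC p hp.1 q hq.1 hw, hD p hp.2 q hq.2 hw⟩

lemma notMem_coh {S C : Set H3bar} {w : H3bar} (hC : HypConvex C) (hS : S ⊆ C) (hw : w ∉ C) :
    w ∉ coh S :=
  fun h => hw (h C ⟨hC, hS⟩)

/-! ### The polytope -/

lemma coe_mem_insert_toBar_domain {z : HalfSpace} :
    (z : H3bar) ∈ insert OnePoint.infty (toBar '' domain) ↔
      z.1.1 ∈ triangle ∧ 2 ≤ ‖z.1.1 - 1‖ ^ 2 + z.1.2 ^ 2 := by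
  constructor
  · rintro (h | ⟨w, h, hw⟩)
    · exact absurd h (OnePoint.coe_ne_infty z)
    · rw [← OnePoint.coe_injective hw]
      exact h
  · rintro ⟨h1, h2⟩
    have h3 := sq_norm_sub_one_le h1
    -- No boundary point of height 0 qualifies, because |x - 1|² ≤ 1 < 2 over the triangle.
    have hy : 0 < z.1.2 := by
      refine z.2.lt_of_ne fun h => ?_
      rw [← h] at h2
      linarith
    exact Or.inr ⟨⟨z.1, hy⟩, ⟨h1, h2⟩, rfl⟩

lemma insert_toBar_domain_eq : insert OnePoint.infty (toBar '' domain) =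
    (upperRegion 1 0 1 ∩ upperRegion (-Complex.I) 0 0) ∩
      (upperRegion (-1 + Complex.I) 0 (-2) ∩ upperRegion (-2) 1 1) := by
  ext w
  induction w using OnePoint.rec with
  | infty => simp [infty_mem_upperRegion]
  | coe z =>
    rw [coe_mem_insert_toBar_domain, mem_triangle_iff, sq_norm_sub_one]
    simp only [Set.mem_inter_iff, coe_mem_upperRegion, HalfSpace.sqNorm, Complex.normSq_apply]
    simp
    constructor
    · rintro ⟨⟨h1, h2, h3⟩, h4⟩
      exact ⟨⟨h1, h2⟩, by linarith, by linarith⟩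
    · rintro ⟨⟨h1, h2⟩, h3, h4⟩
      exact ⟨⟨h1, h2, by linarith⟩, by linarith⟩

lemma hypConvex_insert_toBar_domain : HypConvex (insert OnePoint.infty (toBar '' domain)) := by
  rw [insert_toBar_domain_eq]
  exact ((hypConvex_upperRegion _ le_rfl _).inter (hypConvex_upperRegion _ le_rfl _)).inter
    ((hypConvex_upperRegion _ le_rfl _).inter (hypConvex_upperRegion _ zero_le_one _))

/-- The point over `t` on the sphere of centre `1` and radius `√2`. -/
noncomputable def spherePoint (t : ℂ) : HalfSpace :=
  ⟨(t, √(2 - ‖t - 1‖ ^ 2)), Real.sqrt_nonneg _⟩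

/-- On this sphere |x|² + y² is affine in x, so the segment between two sphere points stays on the
sphere. -/
lemma sqNorm_spherePoint {t : ℂ} (ht : t ∈ triangle) : (spherePoint t).sqNorm = 1 + 2 * t.re := by
  have h := sq_norm_sub_one_le ht
  have h1 : (spherePoint t).1.2 ^ 2 = 2 - ‖t - 1‖ ^ 2 := Real.sq_sqrt (by linarith)
  rw [HalfSpace.sqNorm, h1, sq_norm_sub_one]
  change Complex.normSq t + _ = _
  rw [Complex.normSq_apply]
  ring

lemma combo_mem_triangle {p q : ℂ} (hp : p ∈ triangle) (hq : q ∈ triangle) {s : ℝ}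
    (hs : s ∈ Set.Icc (0 : ℝ) 1) : (1 - s) * p + s * q ∈ triangle := by
  have h : Convex ℝ triangle := convex_convexHull ℝ _
  simpa using h hp hq (sub_nonneg.2 hs.2) hs.1 (sub_add_cancel 1 s)

lemma spherePoint_mem_hypSegment {p q : ℂ} (hp : p ∈ triangle) (hq : q ∈ triangle) {s : ℝ}
    (hs : s ∈ Set.Icc (0 : ℝ) 1) :
    (spherePoint ((1 - s) * p + s * q) : H3bar) ∈ hypSegment (spherePoint p) (spherePoint q) := by
  have ht := combo_mem_triangle hp hq hs
  rw [mem_hypSegment_coe]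
  refine ⟨s, hs, rfl, ?_⟩
  rw [sqNorm_spherePoint ht, sqNorm_spherePoint hp, sqNorm_spherePoint hq]
  simp
  ring

lemma one_mem_triangle : (1 : ℂ) ∈ triangle := subset_convexHull ℝ _ (by simp)

lemma two_mem_triangle : (2 : ℂ) ∈ triangle := subset_convexHull ℝ _ (by simp)

lemma one_add_I_mem_triangle : 1 + Complex.I ∈ triangle := subset_convexHull ℝ _ (by simp)

lemma vertices_zero : vertices 0 = (spherePoint 1 : H3bar) := by
  simp [vertices, toBar, spherePoint]

lemma vertices_one : vertices 1 = (spherePoint 2 : H3bar) := by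
  have : (2 : ℝ) - ‖(2 : ℂ) - 1‖ ^ 2 = 1 := by norm_num
  simp [vertices, toBar, spherePoint, this]

lemma vertices_two : vertices 2 = (spherePoint (1 + Complex.I) : H3bar) := by
  have : (2 : ℝ) - ‖1 + Complex.I - 1‖ ^ 2 = 1 := by norm_num
  simp only [spherePoint, this]
  simp [vertices, toBar]

/-- The right side is convex and contains the vertices. Conversely, a hull point on the spherical
face lies below each of its finite points, and the vertical ray from there to ∞ reaches that point.
-/
lemma polytope_eq : polytope = insert OnePoint.infty (toBar '' domain) := by
  apply Set.Subset.antisymm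
  · refine Set.sInter_subset_of_mem ⟨hypConvex_insert_toBar_domain, ?_⟩
    have h : ∀ t ∈ triangle,
        (spherePoint t : H3bar) ∈ insert OnePoint.infty (toBar '' domain) := by
      intro t ht
      rw [coe_mem_insert_toBar_domain]
      have h1 := sq_norm_sub_one_le ht
      have h2 : (spherePoint t).1.2 ^ 2 = 2 - ‖t - 1‖ ^ 2 := Real.sq_sqrt (by linarith)
      refine ⟨ht, ?_⟩
      rw [h2]
      change 2 ≤ ‖t - 1‖ ^ 2 + _
      linarith
    rintro _ ⟨i, rfl⟩
    fin_cases i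
    · exact vertices_zero ▸ h 1 one_mem_triangle
    · exact vertices_one ▸ h 2 two_mem_triangle
    · exact vertices_two ▸ h _ one_add_I_mem_triangle
    · exact Set.mem_insert _ _
  · rintro w hw C ⟨hC, hS⟩
    have hinf : OnePoint.infty ∈ C := hS ⟨3, rfl⟩
    rcases hw with rfl | ⟨z, ⟨hz, hz2⟩, rfl⟩
    · exact hinf
    have h0 : (spherePoint 1 : H3bar) ∈ C := vertices_zero ▸ hS ⟨0, rfl⟩
    have h1 : (spherePoint 2 : H3bar) ∈ C := vertices_one ▸ hS ⟨1, rfl⟩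
    have h2 : (spherePoint (1 + Complex.I) : H3bar) ∈ C := vertices_two ▸ hS ⟨2, rfl⟩
    obtain ⟨k1, k2, k3⟩ := (mem_triangle_iff _).1 hz
    -- The line from 1 through x meets the side from 2 to 1 + i at parameter r, and s is the
    -- position of x between 1 and that point. At x = 1 the quotient r is 0/0 = 0, which is
    -- harmless.
    set s : ℝ := z.x.re - 1 + z.x.im with hs
    set r : ℝ := z.x.im / s with hr
    have hs0 : 0 ≤ s := by linarith
    have hr01 : r ∈ Set.Icc (0 : ℝ) 1 := ⟨by positivity, div_le_one_of_le₀ (by linarith) hs0⟩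
    have hsr : s * r = z.x.im := by
      rcases hs0.eq_or_lt with h | h
      · rw [← h]
        linarith
      · rw [hr]
        field_simp
    have he := hC _ h1 _ h2 (spherePoint_mem_hypSegment two_mem_triangle
      one_add_I_mem_triangle hr01)
    have het := combo_mem_triangle two_mem_triangle one_add_I_mem_triangle hr01
    have hf := hC _ h0 _ he (spherePoint_mem_hypSegment (s := s) one_mem_triangle het
      ⟨hs0, by linarith⟩)
    have hx : (1 - s) * 1 + s * ((1 - r) * 2 + r * (1 + Complex.I)) = z.x := by
      apply Complex.ext
      · simp
        linarith
      · simp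
        linarith
    rw [hx] at hf
    refine hC _ hf _ hinf (Or.inr ⟨⟨z.1, z.2.le⟩, rfl, rfl, ?_⟩)
    exact Real.sqrt_le_iff.2 ⟨z.y_pos.le, sub_le_iff_le_add'.2 hz2⟩

lemma toBar_preimage_polytope : toBar ⁻¹' polytope = domain := by
  rw [polytope_eq]
  ext z
  exact coe_mem_insert_toBar_domain

/-- Hemispheres miss ∞, and a vertical plane would make 1, 2 and 1 + i collinear. -/
lemma not_coplanar_vertices : ¬ ∃ S, IsTotallyGeodesicSurface S ∧ ∀ i, vertices i ∈ S := by
  rintro ⟨S, ⟨u, hu, k, rfl⟩ | ⟨c, r, -, rfl⟩, h⟩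
  · have hx : ∀ i, ∀ p : HalfSpace, vertices i = (p : H3bar) → (conj u * p.1.1).re = k := by
      intro i p hp
      have hi := h i
      rw [hp] at hi
      rcases hi with hi | ⟨z, hz, hk⟩
      · exact absurd hi (OnePoint.coe_ne_infty p)
      · rwa [OnePoint.coe_injective hz]
    have h0 := hx 0 _ vertices_zero
    have h1 := hx 1 _ vertices_one
    have h2 := hx 2 _ vertices_two
    simp [spherePoint] at h0 h1 h2
    exact hu (Complex.ext (by simp; linarith) (by simp; linarith))
  · obtain ⟨z, hz, -⟩ := h 3
    exact OnePoint.infty_ne_coe z hz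

lemma isSolidConvexPolytope_polytope : IsSolidConvexPolytope vertices polytope where
  three_lt := by norm_num
  not_coplanar := not_coplanar_vertices
  eq_hull := rfl
  vertex := by
    -- Each vertex is separated from the other three by a convex set: a finite one by the vertical
    -- half-space beyond the opposite side of the triangle, and ∞ by the set of all finite points.
    have key : ∀ (i : Fin 4) (C : Set H3bar), HypConvex C → (∀ j, j ≠ i → vertices j ∈ C) →
        vertices i ∉ C → vertices i ∉ coh (vertices '' {i}ᶜ) := by
      intro i C hC hj hi
      refine notMem_coh hC ?_ hi
      rintro _ ⟨j, hj', rfl⟩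
      exact hj j hj'
    intro i
    fin_cases i
    · refine key 0 (upperRegion (1 - Complex.I) 0 2) (hypConvex_upperRegion _ le_rfl _) ?_ ?_
      · intro j hj
        fin_cases j
        · exact absurd rfl hj
        · refine vertices_one ▸ coe_mem_upperRegion.2 ?_
          simp [spherePoint]
        · refine vertices_two ▸ coe_mem_upperRegion.2 ?_
          simp [spherePoint]
          norm_num
        · exact infty_mem_upperRegion _ _ _
      · rw [vertices_zero, coe_mem_upperRegion]
        simp [spherePoint]
    · refine key 1 (upperRegion (-1) 0 (-1)) (hypConvex_upperRegion _ le_rfl _) ?_ ?_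
      · intro j hj
        fin_cases j
        · refine vertices_zero ▸ coe_mem_upperRegion.2 ?_
          simp [spherePoint]
        · exact absurd rfl hj
        · refine vertices_two ▸ coe_mem_upperRegion.2 ?_
          simp [spherePoint]
        · exact infty_mem_upperRegion _ _ _
      · rw [vertices_one, coe_mem_upperRegion]
        simp [spherePoint]
    · refine key 2 (upperRegion Complex.I 0 0) (hypConvex_upperRegion _ le_rfl _) ?_ ?_
      · intro j hj
        fin_cases j
        · refine vertices_zero ▸ coe_mem_upperRegion.2 ?_
          simp [spherePoint]
        · refine vertices_one ▸ coe_mem_upperRegion.2 ?_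
          simp [spherePoint]
        · exact absurd rfl hj
        · exact infty_mem_upperRegion _ _ _
      · rw [vertices_two, coe_mem_upperRegion]
        simp [spherePoint]
    · refine key 3 _ hypConvex_range_coe ?_ ?_
      · intro j hj
        fin_cases j
        · exact ⟨_, vertices_zero.symm⟩
        · exact ⟨_, vertices_one.symm⟩
        · exact ⟨_, vertices_two.symm⟩
        · exact absurd rfl hj
      · rintro ⟨z, hz⟩
        exact OnePoint.coe_ne_infty z hz

end GrenierH3

theorem mainTheorem2 :
    GrenierH3.IsSolidConvexPolytope GrenierH3.vertices GrenierH3.polytope ∧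
    GrenierH3.IsGoodGrenierDomain GrenierH3.Gam GrenierH3.triangle
      (GrenierH3.toBar ⁻¹' GrenierH3.polytope) ∧
    GrenierH3.toBar ⁻¹' GrenierH3.polytope =
      {z : GrenierH3.H3 | z.x ∈ GrenierH3.triangle ∧ 2 ≤ ‖z.x - 1‖ ^ 2 + z.y ^ 2} ∧
    GrenierH3.polytope = insert OnePoint.infty (GrenierH3.toBar ''
      {z : GrenierH3.H3 | z.x ∈ GrenierH3.triangle ∧ 2 ≤ ‖z.x - 1‖ ^ 2 + z.y ^ 2}) := by
  refine ⟨GrenierH3.isSolidConvexPolytope_polytope, ?_, GrenierH3.toBar_preimage_polytope,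
    GrenierH3.polytope_eq⟩
  rw [GrenierH3.toBar_preimage_polytope]
  exact GrenierH3.isGoodGrenierDomain_domain
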